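/- **Setting.** Let $T>0$, $x_0\in\mathbb R^n$, let $V=\{v_1,v_2\}$ have two elements (modes), let $f(\cdot,w):\mathbb R^n\to\mathbb R^n$ be $C^2$ for each $w\in V$, and let $L:\mathbb R^n\to\mathbb R$ be $C^1$. An admissible schedule $\sigma\in\Sigma$ is a control $v:[0,T)\to V$ for which there are finitely many times $0=\tau_0\le\dots\le\tau_N=T$ with $v$ constant on each $[\tau_{i-1},\tau_i)$. Assume that for every $\sigma\in\Sigma$ the equation $\dot x=f(x,v)$, $x(0)=x_0$, has a continuous solution $x_\sigma$ on the whole of $[0,T]$, and that $\|x_\sigma(t)\|\le R$ for all $t\in[0,T]$ and $\sigma\in\Sigma$, with one constant $R$. Put $J(\sigma)=\int_0^T L(x_\sigma(t))\,dt$. For $s\in[0,T]$ and $w\in V$ let $D_{\sigma,s,w}$ be the right derivative at $\gamma=0$ of the cost of the schedule obtained from $\sigma$ by using mode $w$ throughout $[s,s+\gamma)$ (so $D_{\sigma,T,w}=0$). Let $D_{\sigma,s}=\min_{w\in V}D_{\sigma,s,w}$, $D_\sigma=\inf_{s\in[0,T]}D_{\sigma,s}$ (always $\le 0$) and $S_{\sigma,\eta}=\{s\in[0,T]:D_{\sigma,s}\le\eta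 D_\sigma\}$, and let $\mu$ be Lebesgue measure. For a finite union of intervals $A\subset[0,T]$, $\sigma(A)$ is the schedule obtained from $\sigma$ by switching to the other mode at the points of $A$, where an interval of $A$ with endpoints $a<b$ is flipped on $[a,b)$ (and degenerate intervals are ignored), so that controls stay right-continuous. **Algorithm.** Fix $\eta,\beta\in(0,1)$ and $\alpha\in(0,\eta)$. Start from any $\sigma_0\in\Sigma$. Given $\sigma_k$, stop if $D_{\sigma_k}=0$. Otherwise take a mapping $\gamma\mapsto S(\gamma)\subset S_{\sigma_k,\eta}$, $\gamma\in[0,\mu(S_{\sigma_k,\eta})]$, such that each $S(\gamma)$ is a finite union of intervals with $\mu(S(\gamma))=\gamma$; put $\lambda_j=\beta^j\mu(S_{\sigma_k,\eta})$, let $j$ be the least integer $\ge0$ with $J(\sigma_k(S(\lambda_j)))-J(\sigma_k)\le\alpha\lambda_jD_{\sigma_k}$, and set $\sigma_{k+1}=\sigma_k(S(\lambda_j))$. **Claim.** (1) If the algorithm generates an infinite sequence of schedules $\sigma_k$, then all $\sigma_k$ are admissible, $\limsup_{k\to\infty}D_{\sigma_k}=0$, and for every $\varepsilon>0$ there is a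 $k$ with $D_{\sigma_k}>-\varepsilon$. (2) If for every $\sigma\in\Sigma$ with $D_\sigma<0$ a mapping $S$ as above is given, then, from every $\sigma_0\in\Sigma$ and for every $\varepsilon>0$, the algorithm using these mappings produces after finitely many steps an admissible schedule $\sigma$ with $D_\sigma>-\varepsilon$. -/

import Mathlib

open Filter Topology MeasureTheory Set

/-- The data of a bi-modal switched optimal control problem in `ℝⁿ`: the horizon `T`, the initial
state `x₀`, the vector fields `f w` of the two modes `w : Bool`, and the running cost `L`. -/
structure SwitchedSystem (n : ℕ) where
  T : ℝ
  x₀ : EuclideanSpace ℝ (Fin n)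
  f : Bool → EuclideanSpace ℝ (Fin n) → EuclideanSpace ℝ (Fin n)
  L : EuclideanSpace ℝ (Fin n) → ℝ

namespace SwitchedSystem

noncomputable section

variable {n : ℕ} (P : SwitchedSystem n)

/-- `v` is (the input control of) an admissible mode-schedule: there are finitely many times
`0 = τ 0 ≤ τ 1 ≤ … ≤ τ N = T` such that `v` is constant on each `[τ i, τ (i + 1))`.
The values of `v` outside `[0, T)` play no role. -/
def IsAdmissible (v : ℝ → Bool) : Prop :=
  ∃ (N : ℕ) (τ : ℕ → ℝ), Monotone τ ∧ τ 0 = 0 ∧ τ N = P.T ∧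
    ∀ i < N, ∃ w : Bool, ∀ t ∈ Ico (τ i) (τ (i + 1)), v t = w

/-- `x` is a state trajectory on `[0, T]` under the control `v`: it is continuous, starts at `x₀`
and satisfies `ẋ = f(x, v)`.  The derivative is taken from the right, so that the equation makes
sense at the switching times too (`v` is right-continuous). -/
def IsTrajectory (v : ℝ → Bool) (x : ℝ → EuclideanSpace ℝ (Fin n)) : Prop :=
  ContinuousOn x (Icc 0 P.T) ∧ x 0 = P.x₀ ∧
    ∀ t ∈ Ico 0 P.T, HasDerivWithinAt x (P.f (v t) (x t)) (Ici t) t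

open Classical in
/-- The state trajectory under the control `v` (with value `0` if there is none). -/
def state (v : ℝ → Bool) : ℝ → EuclideanSpace ℝ (Fin n) :=
  if h : ∃ x, P.IsTrajectory v x then h.choose else 0

/-- The cost `J(σ) = ∫₀ᵀ L(x(t)) dt`. -/
def cost (v : ℝ → Bool) : ℝ :=
  ∫ t in (0 : ℝ)..P.T, P.L (P.state v t)

open Classical in
/-- The schedule obtained from `v` by inserting the mode `w` throughout `[s, s + γ)`. -/
def insertMode (v : ℝ → Bool) (s γ : ℝ) (w : Bool) : ℝ → Bool :=
  fun t => if t ∈ Ico s (s + γ) then w else v t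

/-- The insertion gradient `D_{σ,s,w}`: the one-sided derivative at `γ = 0⁺` of the cost of the
schedule in which the mode `w` is inserted throughout `[s, s + γ)`.
(For `s = T` the insertion has no effect on `[0, T)` and the derivative is `0`.) -/
def insertionGradient (v : ℝ → Bool) (s : ℝ) (w : Bool) : ℝ :=
  derivWithin (fun γ : ℝ => P.cost (insertMode v s γ w)) (Ici 0) 0

/-- `D_{σ,s} = min {D_{σ,s,w} : w ∈ V}`. -/
def gradAt (v : ℝ → Bool) (s : ℝ) : ℝ :=
  min (P.insertionGradient v s false) (P.insertionGradient v s true)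

/-- The optimality function `D_σ = inf {D_{σ,s} : s ∈ [0, T]}`. -/
def optFun (v : ℝ → Bool) : ℝ :=
  sInf (P.gradAt v '' Icc 0 P.T)

/-- The set `S_{σ,η} = {s ∈ [0, T] : D_{σ,s} ≤ η D_σ}`. -/
def descentSet (η : ℝ) (v : ℝ → Bool) : Set ℝ :=
  {s | s ∈ Icc 0 P.T ∧ P.gradAt v s ≤ η * P.optFun v}

/-- The set `A` is a finite union of intervals (open, closed, half-open or degenerate). -/
def IsFiniteUnionOfIntervals (A : Set ℝ) : Prop :=
  ∃ C : Set (Set ℝ), C.Finite ∧ (∀ I ∈ C, I.OrdConnected) ∧ A = ⋃₀ C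

open Classical in
/-- The schedule `σ(A)` obtained from `v` by flipping the mode on the finite union of intervals
`A`.  As controls are constant on intervals closed on the left and open on the right, an interval
of `A` from `a` to `b` is flipped on `[a, b)`: the mode is flipped at `t` iff all times slightly
larger than `t` are in `A`. -/
def flip (v : ℝ → Bool) (A : Set ℝ) : ℝ → Bool :=
  fun t => if A ∈ 𝓝[>] t then !(v t) else v t

/-- `S` is a mapping from `[0, μ(S_{σ,η})]` to the subsets of `S_{σ,η}` such that each `S γ` is a
finite union of intervals with Lebesgue measure `γ`. -/
def IsSelection (η : ℝ) (v : ℝ → Bool) (S : ℝ → Set ℝ) : Prop :=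
  ∀ γ ∈ Icc 0 (volume.real (P.descentSet η v)),
    S γ ⊆ P.descentSet η v ∧ IsFiniteUnionOfIntervals (S γ) ∧ volume (S γ) = ENNReal.ofReal γ

/-- The trial step `λ_j = β ^ j * μ(S_{σ,η})`. -/
def trialStep (β η : ℝ) (v : ℝ → Bool) (j : ℕ) : ℝ :=
  β ^ j * volume.real (P.descentSet η v)

/-- The indices `j` that pass the Armijo test `J(σ(λ_j)) - J(σ) ≤ α λ_j D_σ`. -/
def armijoIndices (α β η : ℝ) (v : ℝ → Bool) (S : ℝ → Set ℝ) : Set ℕ :=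
  {j | P.cost (flip v (S (P.trialStep β η v j))) - P.cost v ≤
    α * P.trialStep β η v j * P.optFun v}

/-- One iteration of the algorithm, from `v` to `v'`, with the mapping `S` at `v`: the stopping
test `D_σ = 0` fails, `j` is the least index that passes the Armijo test, and the modes are flipped
on `S(λ_j)`. -/
def IsStep (α β η : ℝ) (S : ℝ → Set ℝ) (v v' : ℝ → Bool) : Prop :=
  P.optFun v ≠ 0 ∧ P.IsSelection η v S ∧
    ∃ j, IsLeast (P.armijoIndices α β η v S) j ∧ v' = flip v (S (P.trialStep β η v j))

end

end SwitchedSystem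

/-! The argument rests on a first-order expansion of the cost that is uniform over all schedules.
Let p be the costate along the trajectory x of v and G(t, w) = p(t)(f(w, x(t)) - f(v(t), x(t)))
(`modeGain`). Passing from v to v' changes the cost by ∫ G(t, v'(t)) dt up to o(m), where m is the
measure of the set on which the controls differ, and the rate in o(m) depends on neither control
(`Regular.exists_abs_cost_sub_le`). The uniformity comes from the ball that contains every
trajectory. Applied to insertions, the expansion shows that D_{σ,s,w} = G(s, w) for s < T; since G
vanishes at the current mode, only the gain of the other mode matters.

Two consequences drive the convergence. If D_σ ≤ -ε, flipping a set A ⊆ S_{σ,η} lowers the cost by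
at least η|D_σ|μ(A) - o(μ(A)), so, because α < η, every trial step below a threshold depending only
on ε passes the Armijo test (`Regular.exists_mem_armijoIndices`). And if S_{σ,η} is small in measure
and almost all of it is flipped, the gains change little except that they reverse sign on the
flipped set; the new gains are then at least ηD_σ - ε' everywhere
(`Regular.exists_mul_optFun_sub_le`).

Suppose D_{σ_k} ≤ -ε for all large k. The costs decrease and are bounded below, so the accepted
steps tend to 0. A small accepted step with j > 0 is impossible, since the preceding trial step
would also have been below the threshold. Hence eventually j = 0, all of S_{σ,η} is flipped in
measure, and |D_{σ_k}| contracts by the factor η up to an arbitrarily small error, which contradicts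
|D_{σ_k}| ≥ ε (`Regular.frequently_neg_lt_optFun`). -/

/-! ### Grönwall inequalities and a linear-growth Volterra equation -/

/-- Grönwall's inequality in integral form. -/
theorem le_mul_exp_of_le_add_mul_integral {g : ℝ → ℝ} {a M T : ℝ} (hT : 0 ≤ T) (hM : 0 ≤ M)
    (hg : ContinuousOn g (Icc 0 T))
    (h : ∀ t ∈ Icc 0 T, g t ≤ a + M * ∫ s in (0 : ℝ)..t, g s) :
    ∀ t ∈ Icc 0 T, g t ≤ a * Real.exp (M * t) := by
  -- The continuous extension to the line makes the primitive differentiable at every point,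
  -- endpoints included.
  set G : ℝ → ℝ := IccExtend hT ((Icc 0 T).domRestrict g) with hG
  have hGc : Continuous G := hg.domRestrict.Icc_extend'
  have hGg : ∀ t ∈ Icc 0 T, G t = g t := fun t ht => by
    rw [hG, IccExtend_of_mem hT _ ht]; rfl
  have hd : ∀ t, HasDerivAt (fun t => (a + M * ∫ s in (0 : ℝ)..t, G s) * Real.exp (-(M * t)))
      ((M * G t) * Real.exp (-(M * t)) +
        (a + M * ∫ s in (0 : ℝ)..t, G s) * (Real.exp (-(M * t)) * (-(M * 1)))) t := fun t =>
    (((hGc.integral_hasStrictDerivAt 0 t).hasDerivAt.const_mul M).const_add a).mul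
      (((hasDerivAt_id t).const_mul M).neg.exp)
  have hint : ∀ t ∈ Icc 0 T, ∫ s in (0 : ℝ)..t, G s = ∫ s in (0 : ℝ)..t, g s := fun t ht =>
    intervalIntegral.integral_congr fun s hs => by
      rw [uIcc_of_le ht.1] at hs
      exact hGg s ⟨hs.1, hs.2.trans ht.2⟩
  have hanti : AntitoneOn (fun t => (a + M * ∫ s in (0 : ℝ)..t, G s) * Real.exp (-(M * t)))
      (Icc 0 T) := by
    refine antitoneOn_of_deriv_nonpos (convex_Icc 0 T)
      (fun t _ => (hd t).continuousAt.continuousWithinAt)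
      (fun t _ => (hd t).differentiableAt.differentiableWithinAt) fun t ht => ?_
    rw [interior_Icc] at ht
    have ht' := Ioo_subset_Icc_self ht
    rw [(hd t).deriv]
    have h1 := h t ht'
    rw [← hint t ht', ← hGg t ht'] at h1
    have h2 := mul_nonneg (mul_nonneg hM (Real.exp_pos (-(M * t))).le) (sub_nonneg.2 h1)
    nlinarith
  intro t ht
  have h1 := hanti (left_mem_Icc.2 hT) ht ht.1
  simp only [intervalIntegral.integral_same, mul_zero, add_zero, neg_zero, Real.exp_zero,
    mul_one] at h1
  rw [hint t ht] at h1
  calc g t ≤ a + M * ∫ s in (0 : ℝ)..t, g s := h t ht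
    _ = ((a + M * ∫ s in (0 : ℝ)..t, g s) * Real.exp (-(M * t))) * Real.exp (M * t) := by
      rw [mul_assoc, ← Real.exp_add]; simp
    _ ≤ a * Real.exp (M * t) := by gcongr

/-- Grönwall's inequality in integral form, backwards in time. -/
theorem le_mul_exp_of_le_add_mul_integral_right {g : ℝ → ℝ} {a M T : ℝ} (hT : 0 ≤ T)
    (hM : 0 ≤ M) (hg : ContinuousOn g (Icc 0 T))
    (h : ∀ t ∈ Icc 0 T, g t ≤ a + M * ∫ s in t..T, g s) :
    ∀ t ∈ Icc 0 T, g t ≤ a * Real.exp (M * (T - t)) := by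
  intro t ht
  have hmem : ∀ s ∈ Icc 0 T, T - s ∈ Icc 0 T := fun s hs =>
    ⟨sub_nonneg.2 hs.2, sub_le_self _ hs.1⟩
  have h1 := le_mul_exp_of_le_add_mul_integral (g := fun s => g (T - s)) (a := a) hT hM
    (hg.comp (by fun_prop) hmem) (fun s hs => by
      have := h (T - s) (hmem s hs)
      rw [intervalIntegral.integral_comp_sub_left]
      simpa using this) (T - t) (hmem t ht)
  simpa using h1

/-- Existence for Lipschitz Volterra equations, backwards in time. -/
theorem exists_eq_integral_right {F : Type*} [NormedAddCommGroup F] [NormedSpace ℝ F]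
    [CompleteSpace F] {T M : ℝ} (hT : 0 ≤ T) (hM : 0 ≤ M) (g : ℝ → F → F)
    (hint : ∀ p : ℝ → F, Continuous p → IntervalIntegrable (fun t => g t (p t)) volume 0 T)
    (hlip : ∀ t ∈ Icc 0 T, ∀ p q, ‖g t p - g t q‖ ≤ M * ‖p - q‖) :
    ∃ p : ℝ → F, Continuous p ∧ ∀ t ∈ Icc 0 T, p t = ∫ s in t..T, g s (p s) := by
  -- In the sup norm weighted by exp(-c(T - t)) the integral operator has Lipschitz constant at most
  -- M / c ≤ 1/2; the summand 1 keeps c positive when M = 0.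
  set c : ℝ := 2 * M + 1 with hc
  have hc0 : 0 < c := by positivity
  -- The unknown is the rescaled function q, so that the weighted norm of the solution is the usual
  -- sup norm of q.
  let w : C(Icc 0 T, F) → ℝ → F := fun q s =>
    Real.exp (c * (T - s)) • IccExtend hT q s
  have hw : ∀ q, Continuous (w q) := fun q =>
    (by fun_prop : Continuous fun s : ℝ => Real.exp (c * (T - s))).smul q.continuous.Icc_extend'
  have hsub : ∀ (q : C(Icc 0 T, F)) (t : ℝ), t ∈ Icc 0 T →
      IntervalIntegrable (fun s => g s (w q s)) volume t T := fun q t ht =>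
    (hint _ (hw q)).mono_set (by
      rw [uIcc_of_le ht.2, uIcc_of_le hT]; exact Icc_subset_Icc_left ht.1)
  have hcont : ∀ q : C(Icc 0 T, F),
      ContinuousOn (fun t => ∫ s in t..T, g s (w q s)) (Icc 0 T) := fun q => by
    have h1 := intervalIntegral.continuousOn_primitive_interval_left (μ := volume)
      (f := fun s => g s (w q s)) (a := 0) (b := T) (by
        rw [uIcc_of_le hT, integrableOn_Icc_iff_integrableOn_Ioc]
        exact (intervalIntegrable_iff_integrableOn_Ioc_of_le hT).1 (hint _ (hw q)))
    rwa [uIcc_of_le hT] at h1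
  let Φ : C(Icc 0 T, F) → C(Icc 0 T, F) := fun q =>
    ⟨fun t => Real.exp (-(c * (T - t))) • ∫ s in (t : ℝ)..T, g s (w q s),
      (by fun_prop : Continuous fun t : Icc 0 T => Real.exp (-(c * (T - (t : ℝ))))).smul
        (continuousOn_iff_continuous_domRestrict.1 (hcont q))⟩
  have hΦ : ContractingWith (1 / 2) Φ := by
    refine ⟨by norm_num, LipschitzWith.of_dist_le_mul fun q r => ?_⟩
    rw [ContinuousMap.dist_le (by positivity)]
    rintro ⟨t, ht⟩
    have hb : ‖(∫ s in t..T, g s (w q s)) - ∫ s in t..T, g s (w r s)‖ ≤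
        ∫ s in t..T, M * (Real.exp (c * (T - s)) * dist q r) := by
      rw [← intervalIntegral.integral_sub (hsub q t ht) (hsub r t ht)]
      refine intervalIntegral.norm_integral_le_of_norm_le ht.2 (ae_of_all _ fun s hs => ?_)
        (by apply Continuous.intervalIntegrable; fun_prop)
      refine (hlip s ⟨ht.1.trans hs.1.le, hs.2⟩ _ _).trans ?_
      gcongr
      rw [← smul_sub, norm_smul, Real.norm_eq_abs, Real.abs_exp, ← dist_eq_norm]
      gcongr
      exact ContinuousMap.dist_apply_le_dist _
    have hd : ∀ s, HasDerivAt (fun s => -(M * dist q r / c) * Real.exp (c * (T - s)))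
        (M * (Real.exp (c * (T - s)) * dist q r)) s := fun s => by
      have := ((((hasDerivAt_id s).const_sub T).const_mul c).exp).const_mul
        (-(M * dist q r / c))
      refine this.congr_deriv ?_
      simp only [id]
      field_simp
    have hi : ∫ s in t..T, M * (Real.exp (c * (T - s)) * dist q r) =
        M * dist q r / c * (Real.exp (c * (T - t)) - 1) := by
      rw [intervalIntegral.integral_eq_sub_of_hasDerivAt (fun s _ => hd s)
        (by apply Continuous.intervalIntegrable; fun_prop)]
      simp; ring
    rw [hi] at hb
    rw [dist_eq_norm]
    change ‖Real.exp (-(c * (T - t))) • (∫ s in t..T, g s (w q s)) -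
      Real.exp (-(c * (T - t))) • ∫ s in t..T, g s (w r s)‖ ≤ _
    rw [← smul_sub, norm_smul, Real.norm_eq_abs, Real.abs_exp]
    have hMc : M / c ≤ 1 / 2 := by rw [div_le_div_iff₀ hc0 (by norm_num)]; linarith
    calc _ ≤ Real.exp (-(c * (T - t))) * (M * dist q r / c * Real.exp (c * (T - t))) := by
          gcongr
          refine hb.trans ?_
          gcongr
          linarith
      _ = M / c * dist q r * (Real.exp (-(c * (T - t))) * Real.exp (c * (T - t))) := by ring
      _ = M / c * dist q r := by rw [← Real.exp_add]; simp
      _ ≤ 1 / 2 * dist q r := by gcongr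
      _ = _ := by norm_num
  obtain ⟨q, hq⟩ : ∃ q, Φ q = q := ⟨_, hΦ.fixedPoint_isFixedPt⟩
  refine ⟨w q, hw q, fun t ht => ?_⟩
  have h1 : Real.exp (-(c * (T - t))) • (∫ s in t..T, g s (w q s)) = q ⟨t, ht⟩ :=
    DFunLike.congr_fun hq ⟨t, ht⟩
  change Real.exp (c * (T - t)) • IccExtend hT q t = _
  rw [IccExtend_of_mem hT _ ht, ← h1, smul_smul, ← Real.exp_add]
  simp

/-! ### Finite unions of intervals and admissible controls -/

theorem Set.OrdConnected.finite_frontier {I : Set ℝ} (hI : I.OrdConnected) :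
    (frontier I).Finite := by
  have hp : IsPreconnected I := isPreconnected_iff_ordConnected.2 hI
  have := hp.mem_intervals
  simp only [mem_insert_iff, mem_singleton_iff] at this
  have hc : (frontier (Icc (sInf I) (sSup I))).Finite ∧ (frontier (Ico (sInf I) (sSup I))).Finite ∧
      (frontier (Ioc (sInf I) (sSup I))).Finite ∧ (frontier (Ioo (sInf I) (sSup I))).Finite := by
    rcases lt_or_ge (sInf I) (sSup I) with h | h
    · rw [frontier_Icc h.le, frontier_Ico h, frontier_Ioc h, frontier_Ioo h]
      simp
    · rw [Ico_eq_empty (not_lt.2 h), Ioc_eq_empty (not_lt.2 h), Ioo_eq_empty (not_lt.2 h)]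
      rcases h.eq_or_lt with h | h
      · simp only [h, Icc_self, frontier_empty, finite_empty, and_true]
        exact (finite_singleton _).subset isClosed_singleton.frontier_subset
      · simp [Icc_eq_empty (not_le.2 h)]
  rcases this with h | h | h | h | h | h | h | h | h | h
  · rw [h]; exact hc.1
  · rw [h]; exact hc.2.1
  · rw [h]; exact hc.2.2.1
  · rw [h]; exact hc.2.2.2
  all_goals rw [h]; simp

namespace SwitchedSystem

theorem IsFiniteUnionOfIntervals.finite_frontier {A : Set ℝ} (hA : IsFiniteUnionOfIntervals A) :
    (frontier A).Finite := by
  obtain ⟨C, hC, hI, rfl⟩ := hA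
  induction C, hC using Set.Finite.induction_on with
  | empty => simp
  | @insert I C _ _ ih =>
    rw [sUnion_insert]
    refine Set.Finite.subset ((hI I (mem_insert _ _)).finite_frontier.union
      (ih fun J hJ => hI J (mem_insert_of_mem _ hJ))) ?_
    exact (frontier_union_subset _ _).trans
      (union_subset_union inter_subset_left inter_subset_right)

theorem IsFiniteUnionOfIntervals.measurableSet {A : Set ℝ} (hA : IsFiniteUnionOfIntervals A) :
    MeasurableSet A := by
  obtain ⟨C, hC, hI, rfl⟩ := hA
  exact MeasurableSet.sUnion hC.countable fun I h => (hI I h).measurableSet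

variable {n : ℕ} {P : SwitchedSystem n} {v v' : ℝ → Bool} {R M : ℝ}

/-- Sorting F ∩ [0, T] together with 0 and T gives the partition, as no point of F lies strictly
between neighbours. With the converse `IsAdmissible.exists_finite`, admissibility of a modified
control reduces to adding finitely many points to F, with no merging of partitions. -/
theorem isAdmissible_of_finite (hT : 0 < P.T) {F : Set ℝ} (hF : F.Finite)
    (h : ∀ a b, 0 ≤ a → a < b → b ≤ P.T → Disjoint (Ioo a b) F → ∃ w, ∀ t ∈ Ico a b, v t = w) :
    P.IsAdmissible v := by
  classical
  set s : Finset ℝ := insert 0 (insert P.T (hF.toFinset.filter fun t => t ∈ Icc 0 P.T)) with hs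
  have hsI : ∀ t ∈ s, t ∈ Icc 0 P.T := by
    intro t ht
    simp only [hs, Finset.mem_insert, Finset.mem_filter] at ht
    rcases ht with rfl | rfl | ht
    · exact left_mem_Icc.2 hT.le
    · exact right_mem_Icc.2 hT.le
    · exact ht.2
  have h0 : (0 : ℝ) ∈ s := by simp [hs]
  have hTs : P.T ∈ s := by simp [hs]
  have hFs : ∀ t ∈ F, t ∈ Icc 0 P.T → t ∈ s := fun t ht h' => by
    simp [hs, ht, h'.1, h'.2]
  clear_value s
  obtain ⟨N, hN⟩ : ∃ N, s.card = N + 1 :=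
    ⟨s.card - 1, (Nat.sub_add_cancel (Finset.card_pos.2 ⟨_, h0⟩)).symm⟩
  set e := s.orderEmbOfFin hN with he
  have hemem : ∀ i, e i ∈ s := fun i => s.orderEmbOfFin_mem hN i
  have hesurj : ∀ t ∈ s, ∃ i, e i = t := fun t ht => by
    have : t ∈ Set.range e := by rw [he, s.range_orderEmbOfFin hN]; exact ht
    exact this
  -- Truncating the index at N freezes the sequence at its last point, which keeps it monotone on
  -- all of ℕ.
  refine ⟨N, fun i => e ⟨min i N, by omega⟩, fun i j hij => e.monotone ?_, ?_, ?_, ?_⟩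
  · exact Fin.mk_le_mk.2 (min_le_min_right _ hij)
  · obtain ⟨i, hi⟩ := hesurj 0 h0
    refine le_antisymm ?_ (hsI _ (hemem _)).1
    rw [← hi]
    exact e.monotone (Fin.mk_le_of_le_val (by simp))
  · obtain ⟨i, hi⟩ := hesurj _ hTs
    refine le_antisymm (hsI _ (hemem _)).2 ?_
    rw [← hi]
    exact e.monotone (Fin.le_def.2 (by simpa using Nat.le_of_lt_succ i.2))
  · intro i hi
    refine h _ _ (hsI _ (hemem _)).1 (e.strictMono (Fin.mk_lt_mk.2 ?_)) (hsI _ (hemem _)).2 ?_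
    · omega
    · rw [Set.disjoint_left]
      intro t ht htF
      obtain ⟨j, rfl⟩ := hesurj t (hFs t htF
        ⟨(hsI _ (hemem _)).1.trans ht.1.le, ht.2.le.trans (hsI _ (hemem _)).2⟩)
      have h1 := e.lt_iff_lt.1 ht.1
      have h2 := e.lt_iff_lt.1 ht.2
      rw [Fin.lt_def] at h1 h2
      simp only at h1 h2
      omega

theorem exists_mem_Ico_of_monotone {τ : ℕ → ℝ} {N : ℕ} {t : ℝ} (ht : t ∈ Ico (τ 0) (τ N)) :
    ∃ i < N, t ∈ Ico (τ i) (τ (i + 1)) := by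
  induction N with
  | zero => exact absurd ht (by simp)
  | succ N ih =>
    rcases lt_or_ge t (τ N) with h | h
    · obtain ⟨i, hi, hi'⟩ := ih ⟨ht.1, h⟩
      exact ⟨i, hi.trans N.lt_succ_self, hi'⟩
    · exact ⟨N, N.lt_succ_self, h, ht.2⟩

theorem IsAdmissible.exists_finite (hv : P.IsAdmissible v) :
    ∃ F : Set ℝ, F.Finite ∧ ∀ a b, 0 ≤ a → a < b → b ≤ P.T → Disjoint (Ioo a b) F →
      ∃ w, ∀ t ∈ Ico a b, v t = w := by
  obtain ⟨N, τ, -, h0, hN, hτ⟩ := hv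
  refine ⟨τ '' Iic N, (finite_Iic N).image τ, fun a b ha hab hb hd => ?_⟩
  obtain ⟨i, hi, hai⟩ := exists_mem_Ico_of_monotone (τ := τ) (N := N) (t := a)
    ⟨h0.trans_le ha, hab.trans_le (hb.trans_eq hN.symm)⟩
  have hbi : b ≤ τ (i + 1) := by
    by_contra! hlt
    exact Set.disjoint_left.1 hd ⟨hai.2, hlt⟩ (mem_image_of_mem τ (mem_Iic.2 hi))
  obtain ⟨w, hw⟩ := hτ i hi
  exact ⟨w, fun t ht => hw t ⟨hai.1.trans ht.1, ht.2.trans_le hbi⟩⟩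

theorem IsAdmissible.measurableSet (hv : P.IsAdmissible v) (w : Bool) :
    MeasurableSet {t | t ∈ Ico 0 P.T ∧ v t = w} := by
  obtain ⟨N, τ, hmono, h0, hN, hτ⟩ := hv
  have : {t | t ∈ Ico 0 P.T ∧ v t = w} =
      ⋃ i ∈ Finset.range N, {t | t ∈ Ico (τ i) (τ (i + 1)) ∧ v t = w} := by
    ext t
    simp only [mem_ofPred_eq, mem_iUnion, Finset.mem_range, exists_prop]
    constructor
    · rintro ⟨ht, hw⟩
      rw [← h0, ← hN] at ht
      obtain ⟨i, hi, hti⟩ := exists_mem_Ico_of_monotone ht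
      exact ⟨i, hi, hti, hw⟩
    · rintro ⟨i, hi, ht, hw⟩
      exact ⟨⟨h0.symm.trans_le ((hmono (Nat.zero_le i)).trans ht.1),
        (ht.2.trans_le (hmono hi)).trans_eq hN⟩, hw⟩
  rw [this]
  refine Finset.measurableSet_biUnion _ fun i hi => ?_
  obtain ⟨u, hu⟩ := hτ i (Finset.mem_range.1 hi)
  rcases eq_or_ne u w with rfl | hne
  · have : {t | t ∈ Ico (τ i) (τ (i + 1)) ∧ v t = u} = Ico (τ i) (τ (i + 1)) := by
      ext t; exact ⟨fun h => h.1, fun h => ⟨h, hu t h⟩⟩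
    rw [this]; exact measurableSet_Ico
  · have : {t | t ∈ Ico (τ i) (τ (i + 1)) ∧ v t = w} = ∅ := by
      ext t; exact ⟨fun h => hne ((hu t h.1).symm.trans h.2), fun h => h.elim⟩
    rw [this]; exact MeasurableSet.empty

theorem IsAdmissible.exists_right_const (hv : P.IsAdmissible v) {t : ℝ} (ht : t ∈ Ico 0 P.T) :
    ∃ r, t < r ∧ r ≤ P.T ∧ ∀ s ∈ Ico t r, v s = v t := by
  obtain ⟨N, τ, hmono, h0, hN, hτ⟩ := hv
  rw [← h0, ← hN] at ht
  obtain ⟨i, hi, hti⟩ := exists_mem_Ico_of_monotone ht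
  obtain ⟨w, hw⟩ := hτ i hi
  exact ⟨τ (i + 1), hti.2, (hmono hi).trans_eq hN, fun s hs =>
    (hw s ⟨hti.1.trans hs.1, hs.2⟩).trans (hw t hti).symm⟩

theorem IsAdmissible.congr (hv : P.IsAdmissible v) (h : ∀ t ∈ Ico 0 P.T, v t = v' t) :
    P.IsAdmissible v' := by
  obtain ⟨N, τ, hmono, h0, hN, hτ⟩ := hv
  refine ⟨N, τ, hmono, h0, hN, fun i hi => ?_⟩
  obtain ⟨w, hw⟩ := hτ i hi
  exact ⟨w, fun t ht => (h t ⟨h0.symm.trans_le ((hmono (Nat.zero_le i)).trans ht.1),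
    (ht.2.trans_le (hmono hi)).trans_eq hN⟩).symm.trans (hw t ht)⟩

theorem IsAdmissible.insertMode (hT : 0 < P.T) (hv : P.IsAdmissible v) (s γ : ℝ) (w : Bool) :
    P.IsAdmissible (SwitchedSystem.insertMode v s γ w) := by
  obtain ⟨F, hF, h⟩ := hv.exists_finite
  refine isAdmissible_of_finite hT (hF.union ((finite_singleton s).insert (s + γ)))
    fun a b ha hab hb hd => ?_
  obtain ⟨u, hu⟩ := h a b ha hab hb (hd.mono_right subset_union_left)
  have hs : ¬ (a < s ∧ s < b) := fun h => Set.disjoint_left.1 hd h (by simp)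
  have hγ : ¬ (a < s + γ ∧ s + γ < b) := fun h => Set.disjoint_left.1 hd h (by simp)
  by_cases hmem : a ∈ Ico s (s + γ)
  · refine ⟨w, fun t ht => if_pos ⟨hmem.1.trans ht.1, ?_⟩⟩
    by_contra! hle
    exact hγ ⟨hmem.2, hle.trans_lt ht.2⟩
  · refine ⟨u, fun t ht => (if_neg fun htm => hmem ⟨?_, ht.1.trans_lt htm.2⟩).trans (hu t ht)⟩
    by_contra! hlt
    exact hs ⟨hlt, htm.1.trans_lt ht.2⟩

/-- By connectedness, an open interval that avoids the frontier lies in the interior of A or in the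
complement of its closure. Hence flipping acts the same way at all points of [a, b), the left
endpoint included. -/
theorem mem_nhdsGT_iff_of_disjoint_frontier {A : Set ℝ} {a b t : ℝ}
    (hd : Disjoint (Ioo a b) (frontier A)) (ht : t ∈ Ico a b) :
    A ∈ 𝓝[>] t ↔ Ioo a b ⊆ A := by
  have hmem : Ioo a b ∈ 𝓝[>] t := mem_of_superset (Ioo_mem_nhdsGT ht.2) (Ioo_subset_Ioo_left ht.1)
  refine ⟨fun hA => ?_, fun h => mem_of_superset hmem h⟩
  by_contra hnot
  obtain ⟨s, hs⟩ := Filter.nonempty_of_mem (inter_mem hA hmem)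
  obtain ⟨y, hy, hyA⟩ := not_subset.1 hnot
  have hf : ∀ z ∈ Ioo a b, z ∉ frontier A := fun z hz => Set.disjoint_left.1 hd hz
  have hint : ∀ z ∈ Ioo a b, z ∈ A → z ∈ interior A := fun z hz hzA => by
    by_contra hi
    exact hf z hz ⟨subset_closure hzA, hi⟩
  have hcl : ∀ z ∈ Ioo a b, z ∉ A → z ∈ (closure A)ᶜ := fun z hz hzA hc =>
    hf z hz ⟨hc, fun hi => hzA (interior_subset hi)⟩
  obtain ⟨z, -, hz⟩ := (isPreconnected_Ioo (a := a) (b := b)) _ _ isOpen_interior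
    isClosed_closure.isOpen_compl
    (fun z hz => (em (z ∈ A)).imp (hint z hz) (hcl z hz))
    ⟨s, hs.2, hint s hs.2 hs.1⟩ ⟨y, hy, hcl y hy hyA⟩
  exact hz.2 (subset_closure (interior_subset hz.1))

theorem IsAdmissible.flip (hT : 0 < P.T) (hv : P.IsAdmissible v) {A : Set ℝ}
    (hA : IsFiniteUnionOfIntervals A) : P.IsAdmissible (SwitchedSystem.flip v A) := by
  obtain ⟨F, hF, h⟩ := hv.exists_finite
  refine isAdmissible_of_finite hT (hF.union hA.finite_frontier) fun a b ha hab hb hd => ?_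
  obtain ⟨u, hu⟩ := h a b ha hab hb (hd.mono_right subset_union_left)
  have hd' := hd.mono_right (subset_union_right (s := F))
  by_cases hsub : Ioo a b ⊆ A
  · exact ⟨!u, fun t ht => (if_pos ((mem_nhdsGT_iff_of_disjoint_frontier hd' ht).2 hsub)).trans
      (by rw [hu t ht])⟩
  · exact ⟨u, fun t ht => (if_neg fun h =>
      hsub ((mem_nhdsGT_iff_of_disjoint_frontier hd' ht).1 h)).trans (hu t ht)⟩

theorem mem_nhdsGT_iff_of_notMem_frontier {A : Set ℝ} {t : ℝ} (ht : t ∉ frontier A) :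
    A ∈ 𝓝[>] t ↔ t ∈ A := by
  constructor
  · intro h
    by_contra hA
    have hc : (closure A)ᶜ ∈ 𝓝[>] t := mem_nhdsWithin_of_mem_nhds
      (isClosed_closure.isOpen_compl.mem_nhds fun hcl => ht ⟨hcl, fun hi => hA (interior_subset hi)⟩)
    obtain ⟨s, hs⟩ := Filter.nonempty_of_mem (inter_mem h hc)
    exact hs.2 (subset_closure hs.1)
  · intro h
    refine mem_nhdsWithin_of_mem_nhds (mem_interior_iff_mem_nhds.1 ?_)
    by_contra hi
    exact ht ⟨subset_closure h, hi⟩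

/-- The integrand jumps with the control, but on [0, T) it is the sum over the two modes of a
continuous function times the indicator of the times spent in that mode. -/
theorem IsAdmissible.intervalIntegrable {F : Type*} [NormedAddCommGroup F]
    (hv : P.IsAdmissible v) {g : Bool → ℝ → F} (hg : ∀ w, ContinuousOn (g w) (Icc 0 P.T))
    {a b : ℝ} (ha : a ∈ Icc 0 P.T) (hb : b ∈ Icc 0 P.T) :
    IntervalIntegrable (fun t => g (v t) t) volume a b := by
  have hi : ∀ w, IntegrableOn (fun t => {t | t ∈ Ico 0 P.T ∧ v t = w}.indicator (g w) t)
      (Ico 0 P.T) := fun w =>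
    (((hg w).integrableOn_compact isCompact_Icc).mono_set Ico_subset_Icc_self).indicator
      (hv.measurableSet w)
  have h1 : IntegrableOn (fun t => g (v t) t) (Ico 0 P.T) := by
    refine ((hi true).add (hi false)).congr_fun (fun t ht => ?_) measurableSet_Ico
    have hm : ∀ w, t ∈ {t | t ∈ Ico 0 P.T ∧ v t = w} ↔ v t = w := fun w =>
      ⟨fun h => h.2, fun h => ⟨ht, h⟩⟩
    simp only [Pi.add_apply, indicator_apply, hm]
    rcases hvt : v t <;> simp
  rw [← integrableOn_Icc_iff_integrableOn_Ico] at h1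
  rw [intervalIntegrable_iff]
  exact h1.mono_set (uIoc_subset_uIcc.trans (uIcc_subset_Icc ha hb))

/-! ### Uniform bounds and uniqueness of trajectories -/

/-- The regularity hypotheses on `P`, with uniform bounds: all trajectories of admissible schedules
stay in the ball of radius `R`, where the data and their derivatives are bounded by `M`. -/
structure Regular (P : SwitchedSystem n) (R M : ℝ) : Prop where
  T_pos : 0 < P.T
  contDiff_f : ∀ w, ContDiff ℝ 1 (P.f w)
  contDiff_L : ContDiff ℝ 1 P.L
  exists_trajectory : ∀ v, P.IsAdmissible v →
    ∃ x, P.IsTrajectory v x ∧ ∀ t ∈ Icc 0 P.T, ‖x t‖ ≤ R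
  norm_f_le : ∀ w, ∀ x ∈ Metric.closedBall 0 R, ‖P.f w x‖ ≤ M
  norm_fderiv_f_le : ∀ w, ∀ x ∈ Metric.closedBall 0 R, ‖fderiv ℝ (P.f w) x‖ ≤ M
  abs_L_le : ∀ x ∈ Metric.closedBall 0 R, |P.L x| ≤ M
  norm_fderiv_L_le : ∀ x ∈ Metric.closedBall 0 R, ‖fderiv ℝ P.L x‖ ≤ M

theorem exists_regular (hT : 0 < P.T) (hf : ∀ w, ContDiff ℝ 1 (P.f w)) (hL : ContDiff ℝ 1 P.L)
    (hx : ∃ R : ℝ, ∀ v, P.IsAdmissible v →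
      ∃ x, P.IsTrajectory v x ∧ ∀ t ∈ Set.Icc 0 P.T, ‖x t‖ ≤ R) :
    ∃ R M, P.Regular R M := by
  obtain ⟨R, hR⟩ := hx
  have hB : IsCompact (Metric.closedBall (0 : EuclideanSpace ℝ (Fin n)) R) :=
    isCompact_closedBall 0 R
  have h1 : ∀ w, ∃ C, ∀ x ∈ Metric.closedBall 0 R, ‖P.f w x‖ ≤ C := fun w =>
    hB.exists_bound_of_continuousOn (hf w).continuous.continuousOn
  have h2 : ∀ w, ∃ C, ∀ x ∈ Metric.closedBall 0 R, ‖fderiv ℝ (P.f w) x‖ ≤ C := fun w =>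
    hB.exists_bound_of_continuousOn ((hf w).continuous_fderiv one_ne_zero).continuousOn
  obtain ⟨c₁, h3⟩ := hB.exists_bound_of_continuousOn hL.continuous.continuousOn
  obtain ⟨c₂, h4⟩ := hB.exists_bound_of_continuousOn
    (hL.continuous_fderiv one_ne_zero).continuousOn
  choose C₁ h1 using h1
  choose C₂ h2 using h2
  refine ⟨R, max (max c₁ c₂) (max (max (C₁ true) (C₁ false)) (max (C₂ true) (C₂ false))), hT, hf,
    hL, hR, ?_, ?_, ?_, ?_⟩
  · rintro (_ | _) x hx
    · exact (h1 _ x hx).trans (by simp)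
    · exact (h1 _ x hx).trans (by simp)
  · rintro (_ | _) x hx
    · exact (h2 _ x hx).trans (by simp)
    · exact (h2 _ x hx).trans (by simp)
  · exact fun x hx => (h3 x hx).trans (by simp)
  · exact fun x hx => (h4 x hx).trans (by simp)

theorem IsTrajectory.congr {x : ℝ → EuclideanSpace ℝ (Fin n)} (hx : P.IsTrajectory v x)
    (h : ∀ t ∈ Ico 0 P.T, v t = v' t) : P.IsTrajectory v' x :=
  ⟨hx.1, hx.2.1, fun t ht => h t ht ▸ hx.2.2 t ht⟩

theorem IsTrajectory.eqOn (hf : ∀ w, ContDiff ℝ 1 (P.f w)) {x y : ℝ → EuclideanSpace ℝ (Fin n)}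
    (hx : P.IsTrajectory v x) (hy : P.IsTrajectory v y) : EqOn x y (Icc 0 P.T) := by
  obtain ⟨a, ha⟩ := isCompact_Icc.exists_bound_of_continuousOn hx.1
  obtain ⟨b, hb⟩ := isCompact_Icc.exists_bound_of_continuousOn hy.1
  have h : ∀ w, ∃ K : NNReal, LipschitzOnWith K (P.f w) (Metric.closedBall 0 (max a b)) :=
    fun w => by
      obtain ⟨C, hC⟩ := (isCompact_closedBall (0 : EuclideanSpace ℝ (Fin n))
        (max a b)).exists_bound_of_continuousOn
          ((hf w).continuous_fderiv one_ne_zero).continuousOn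
      exact ⟨Real.toNNReal C, (convex_closedBall 0 _).lipschitzOnWith_of_nnnorm_fderiv_le
        (fun x _ => ((hf w).differentiable one_ne_zero).differentiableAt)
        fun x hx => by
          rw [← NNReal.coe_le_coe, coe_nnnorm]
          exact (hC x hx).trans (Real.le_coe_toNNReal C)⟩
  choose K hK using h
  refine ODE_solution_unique_of_mem_Icc_right (v := fun t => P.f (v t)) (K := max (K true) (K false))
    (s := fun _ => Metric.closedBall 0 (max a b)) (fun t _ => ?_) hx.1 hx.2.2 (fun t ht => ?_)
    hy.1 hy.2.2 (fun t ht => ?_) (hx.2.1.trans hy.2.1.symm)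
  · rcases v t
    · exact (hK false).weaken (le_max_right _ _)
    · exact (hK true).weaken (le_max_left _ _)
  · exact mem_closedBall_zero_iff.2 ((ha t (Ico_subset_Icc_self ht)).trans (le_max_left _ _))
  · exact mem_closedBall_zero_iff.2 ((hb t (Ico_subset_Icc_self ht)).trans (le_max_right _ _))

namespace Regular

theorem isTrajectory_state (h : P.Regular R M) (hv : P.IsAdmissible v) :
    P.IsTrajectory v (P.state v) := by
  have hex : ∃ x, P.IsTrajectory v x := (h.exists_trajectory v hv).imp fun _ hx => hx.1
  rw [state, dif_pos hex]
  exact hex.choose_spec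

/-- The trajectory picked by `state` need not be the one that comes with the bound R; uniqueness for
the differential equation identifies the two on [0, T]. -/
theorem state_mem (h : P.Regular R M) (hv : P.IsAdmissible v) {t : ℝ} (ht : t ∈ Icc 0 P.T) :
    P.state v t ∈ Metric.closedBall 0 R := by
  obtain ⟨x, hx, hR⟩ := h.exists_trajectory v hv
  rw [(h.isTrajectory_state hv).eqOn h.contDiff_f hx ht]
  exact mem_closedBall_zero_iff.2 (hR t ht)

theorem continuousOn_state (h : P.Regular R M) (hv : P.IsAdmissible v) :
    ContinuousOn (P.state v) (Icc 0 P.T) :=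
  (h.isTrajectory_state hv).1

theorem M_nonneg (h : P.Regular R M) : 0 ≤ M := by
  have hv : P.IsAdmissible fun _ => true :=
    isAdmissible_of_finite h.T_pos finite_empty fun _ _ _ _ _ _ => ⟨true, fun _ _ => rfl⟩
  exact (abs_nonneg _).trans (h.abs_L_le _ (h.state_mem hv (left_mem_Icc.2 h.T_pos.le)))

theorem state_eqOn (h : P.Regular R M) (hv : P.IsAdmissible v)
    (hvv : ∀ t ∈ Ico 0 P.T, v t = v' t) : EqOn (P.state v) (P.state v') (Icc 0 P.T) :=
  ((h.isTrajectory_state hv).congr hvv).eqOn h.contDiff_f (h.isTrajectory_state (hv.congr hvv))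

theorem cost_eq (h : P.Regular R M) (hv : P.IsAdmissible v)
    (hvv : ∀ t ∈ Ico 0 P.T, v t = v' t) : P.cost v = P.cost v' :=
  intervalIntegral.integral_congr fun t ht => by
    rw [uIcc_of_le h.T_pos.le] at ht
    simp only [h.state_eqOn hv hvv ht]

theorem abs_cost_le (h : P.Regular R M) (hv : P.IsAdmissible v) : |P.cost v| ≤ M * P.T := by
  have := intervalIntegral.norm_integral_le_of_norm_le_const (a := 0) (b := P.T)
    (f := fun t => P.L (P.state v t)) (C := M) fun t ht => by
      rw [uIoc_of_le h.T_pos.le] at ht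
      exact h.abs_L_le _ (h.state_mem hv (Ioc_subset_Icc_self ht))
  simpa [cost, abs_of_pos h.T_pos] using this

theorem continuousOn_f_state (h : P.Regular R M) (hv : P.IsAdmissible v) (w : Bool) :
    ContinuousOn (fun t => P.f w (P.state v t)) (Icc 0 P.T) :=
  (h.contDiff_f w).continuous.comp_continuousOn (h.continuousOn_state hv)

theorem continuousOn_fderiv_f_state (h : P.Regular R M) (hv : P.IsAdmissible v) (w : Bool) :
    ContinuousOn (fun t => fderiv ℝ (P.f w) (P.state v t)) (Icc 0 P.T) :=
  ((h.contDiff_f w).continuous_fderiv one_ne_zero).comp_continuousOn (h.continuousOn_state hv)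

theorem continuousOn_fderiv_L_state (h : P.Regular R M) (hv : P.IsAdmissible v) :
    ContinuousOn (fun t => fderiv ℝ P.L (P.state v t)) (Icc 0 P.T) :=
  (h.contDiff_L.continuous_fderiv one_ne_zero).comp_continuousOn (h.continuousOn_state hv)

end Regular

/-! ### Measure of the set where two controls differ -/

/-- The set of times in `[0, T)` at which two controls differ. -/
def switchSet (P : SwitchedSystem n) (v v' : ℝ → Bool) : Set ℝ :=
  {t | t ∈ Ico 0 P.T ∧ v t ≠ v' t}

theorem switchSet_subset : P.switchSet v v' ⊆ Ico 0 P.T := fun _ ht => ht.1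

theorem volume_switchSet_ne_top : volume (P.switchSet v v') ≠ ⊤ :=
  measure_ne_top_of_subset switchSet_subset measure_Ico_lt_top.ne

theorem measurableSet_switchSet (hv : P.IsAdmissible v) (hv' : P.IsAdmissible v') :
    MeasurableSet (P.switchSet v v') := by
  have : P.switchSet v v' =
      ({t | t ∈ Ico 0 P.T ∧ v t = true} ∩ {t | t ∈ Ico 0 P.T ∧ v' t = false}) ∪
      ({t | t ∈ Ico 0 P.T ∧ v t = false} ∩ {t | t ∈ Ico 0 P.T ∧ v' t = true}) := by
    ext t
    simp only [switchSet, mem_union, mem_inter_iff, mem_ofPred_eq]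
    rcases v t <;> rcases v' t <;> simp
  rw [this]
  exact ((hv.measurableSet _).inter (hv'.measurableSet _)).union
    ((hv.measurableSet _).inter (hv'.measurableSet _))

/-- Almost everywhere on the interval the integrand is dominated by c times the indicator of the
switch set. This is how the measure of that set, rather than the length of the interval, enters the
perturbation estimates. -/
theorem norm_integral_le_of_eq_zero_off_switchSet {F : Type*} [NormedAddCommGroup F]
    [NormedSpace ℝ F] (hv : P.IsAdmissible v) (hv' : P.IsAdmissible v') {g : ℝ → F} {c : ℝ}
    (hc : 0 ≤ c) (hg : ∀ t ∈ Ico 0 P.T, ‖g t‖ ≤ c)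
    (hg0 : ∀ t ∈ Ico 0 P.T, v t = v' t → g t = 0) {a b : ℝ} (ha : 0 ≤ a) (hab : a ≤ b)
    (hb : b ≤ P.T) :
    ‖∫ t in a..b, g t‖ ≤ c * volume.real (P.switchSet v v') := by
  have hm := measurableSet_switchSet hv hv'
  have hi : Integrable ((P.switchSet v v').indicator fun _ => c) :=
    (integrable_indicator_iff hm).2 (integrableOn_const volume_switchSet_ne_top)
  have hT : ∀ᵐ t : ℝ, t ≠ P.T := compl_mem_ae_iff.2 (measure_singleton _)
  refine (intervalIntegral.norm_integral_le_of_norm_le hab (hT.mono fun t htT ht => ?_)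
    hi.intervalIntegrable).trans ?_
  · have htI : t ∈ Ico 0 P.T := ⟨ha.trans ht.1.le, lt_of_le_of_ne (ht.2.trans hb) htT⟩
    by_cases h : v t = v' t
    · rw [hg0 t htI h, norm_zero]
      exact indicator_nonneg (fun _ _ => hc) _
    · rw [indicator_of_mem (show t ∈ P.switchSet v v' from ⟨htI, h⟩)]
      exact hg t htI
  · rw [intervalIntegral.integral_of_le hab]
    refine (setIntegral_le_integral hi (ae_of_all _ (indicator_nonneg fun _ _ => hc))).trans ?_
    rw [integral_indicator hm, setIntegral_const, smul_eq_mul, mul_comm]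

/-! ### The costate and the uniform first-order expansion of the cost -/

/-- `p` is the costate along the trajectory of `v`: the solution of the adjoint equation
`-ṗ = p ∘ ∂ₓf(x, v) + L'(x)`, `p(T) = 0`, in integral form. -/
def IsCostate (P : SwitchedSystem n) (v : ℝ → Bool)
    (p : ℝ → EuclideanSpace ℝ (Fin n) →L[ℝ] ℝ) : Prop :=
  Continuous p ∧ ∀ t ∈ Icc 0 P.T, p t = ∫ s in t..P.T,
    ((p s).comp (fderiv ℝ (P.f (v s)) (P.state v s)) + fderiv ℝ P.L (P.state v s))

open Classical in
/-- The costate along the trajectory of `v` (with value `0` if there is none). -/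
noncomputable def costate (P : SwitchedSystem n) (v : ℝ → Bool) :
    ℝ → EuclideanSpace ℝ (Fin n) →L[ℝ] ℝ :=
  if h : ∃ p, P.IsCostate v p then h.choose else 0

/-- The first-order effect on the cost of using the mode `w` at time `t`. -/
noncomputable def modeGain (P : SwitchedSystem n) (v : ℝ → Bool) (t : ℝ) (w : Bool) : ℝ :=
  P.costate v t (P.f w (P.state v t) - P.f (v t) (P.state v t))

namespace Regular

theorem norm_f_sub_le (h : P.Regular R M) (w : Bool) {x y : EuclideanSpace ℝ (Fin n)}
    (hx : x ∈ Metric.closedBall 0 R) (hy : y ∈ Metric.closedBall 0 R) : ‖P.f w y - P.f w x‖ ≤ M * ‖y - x‖ :=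
  (convex_closedBall 0 R).norm_image_sub_le_of_norm_fderiv_le
    (fun _ _ => ((h.contDiff_f w).differentiable one_ne_zero).differentiableAt)
    (h.norm_fderiv_f_le w) hx hy

theorem intervalIntegrable_f_state (h : P.Regular R M) (hv : P.IsAdmissible v) {a b : ℝ}
    (ha : a ∈ Icc 0 P.T) (hb : b ∈ Icc 0 P.T) :
    IntervalIntegrable (fun t => P.f (v t) (P.state v t)) volume a b :=
  hv.intervalIntegrable (h.continuousOn_f_state hv) ha hb

theorem state_sub_eq_integral (h : P.Regular R M) (hv : P.IsAdmissible v)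
    (hv' : P.IsAdmissible v') {t : ℝ} (ht : t ∈ Icc 0 P.T) :
    P.state v' t - P.state v t =
      ∫ s in (0 : ℝ)..t, (P.f (v' s) (P.state v' s) - P.f (v s) (P.state v s)) := by
  have h0 := left_mem_Icc.2 h.T_pos.le
  have key : ∀ {u : ℝ → Bool}, P.IsAdmissible u →
      ∫ s in (0 : ℝ)..t, P.f (u s) (P.state u s) = P.state u t - P.x₀ := fun {u} hu => by
    have hx := h.isTrajectory_state hu
    rw [← hx.2.1]
    exact intervalIntegral.integral_eq_sub_of_hasDeriv_right_of_le ht.1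
      (hx.1.mono (Icc_subset_Icc_right ht.2))
      (fun s hs => (hx.2.2 s ⟨hs.1.le, hs.2.trans_le ht.2⟩).mono Ioi_subset_Ici_self)
      (h.intervalIntegrable_f_state hu h0 ht)
  rw [intervalIntegral.integral_sub (h.intervalIntegrable_f_state hv' h0 ht)
    (h.intervalIntegrable_f_state hv h0 ht), key hv, key hv']
  abel

/-- Inserting f(v', x) splits the difference of velocities into a change of mode along x, which
lives on the switch set and integrates to at most 2M times its measure, and a term bounded by M‖x' -
x‖, which Grönwall absorbs. -/
theorem exists_norm_state_sub_le (h : P.Regular R M) :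
    ∃ C, 0 ≤ C ∧ ∀ v v', P.IsAdmissible v → P.IsAdmissible v' → ∀ t ∈ Icc 0 P.T,
      ‖P.state v' t - P.state v t‖ ≤ C * volume.real (P.switchSet v v') := by
  refine ⟨|2 * M * Real.exp (M * P.T)|, abs_nonneg _, fun v v' hv hv' t ht => ?_⟩
  have hM := h.M_nonneg
  have h0 := left_mem_Icc.2 h.T_pos.le
  have hy : ContinuousOn (fun t => P.state v' t - P.state v t) (Icc 0 P.T) :=
    (h.continuousOn_state hv').sub (h.continuousOn_state hv)
  refine (le_mul_exp_of_le_add_mul_integral h.T_pos.le hM hy.norm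
    (a := 2 * M * volume.real (P.switchSet v v')) (fun t ht => ?_) t ht).trans ?_
  · have hi1 : IntervalIntegrable (fun s => P.f (v' s) (P.state v s)) volume 0 t :=
      hv'.intervalIntegrable (h.continuousOn_f_state hv) h0 ht
    have hsplit : P.state v' t - P.state v t =
        (∫ s in (0 : ℝ)..t, (P.f (v' s) (P.state v s) - P.f (v s) (P.state v s))) +
        ∫ s in (0 : ℝ)..t, (P.f (v' s) (P.state v' s) - P.f (v' s) (P.state v s)) := by
      rw [h.state_sub_eq_integral hv hv' ht, ← intervalIntegral.integral_add
        (hi1.sub (h.intervalIntegrable_f_state hv h0 ht))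
        ((h.intervalIntegrable_f_state hv' h0 ht).sub hi1)]
      simp
    rw [hsplit]
    refine (norm_add_le _ _).trans (add_le_add ?_ ?_)
    · refine norm_integral_le_of_eq_zero_off_switchSet hv hv' (by positivity) (fun s hs => ?_)
        (fun s _ hs => by rw [hs, sub_self]) le_rfl ht.1 ht.2
      have hm := h.state_mem hv (Ico_subset_Icc_self hs)
      refine (norm_sub_le _ _).trans ?_
      linarith [h.norm_f_le (v s) _ hm, h.norm_f_le (v' s) _ hm]
    · rw [← intervalIntegral.integral_const_mul]
      refine intervalIntegral.norm_integral_le_of_norm_le ht.1 (ae_of_all _ fun s hs => ?_)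
        ((continuousOn_const.mul (hy.norm.mono ?_)).intervalIntegrable)
      · have hs' : s ∈ Icc 0 P.T := ⟨hs.1.le, hs.2.trans ht.2⟩
        exact h.norm_f_sub_le _ (h.state_mem hv hs') (h.state_mem hv' hs')
      · rw [uIcc_of_le ht.1]; exact Icc_subset_Icc_right ht.2
  · rw [abs_of_nonneg (by positivity)]
    have : M * t ≤ M * P.T := mul_le_mul_of_nonneg_left ht.2 hM
    calc _ ≤ 2 * M * volume.real (P.switchSet v v') * Real.exp (M * P.T) := by gcongr
      _ = _ := by ring

theorem exists_isCostate (h : P.Regular R M) (hv : P.IsAdmissible v) :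
    ∃ p, P.IsCostate v p := by
  refine exists_eq_integral_right (M := M) h.T_pos.le (h.M_nonneg)
    (fun s p => p.comp (fderiv ℝ (P.f (v s)) (P.state v s)) + fderiv ℝ P.L (P.state v s))
    (fun p hp => ?_) (fun t ht p q => ?_)
  · exact hv.intervalIntegrable (g := fun w s => (p s).comp (fderiv ℝ (P.f w) (P.state v s)) +
      fderiv ℝ P.L (P.state v s)) (fun w => (hp.continuousOn.clm_comp
        (h.continuousOn_fderiv_f_state hv w)).add (h.continuousOn_fderiv_L_state hv))
      (left_mem_Icc.2 h.T_pos.le) (right_mem_Icc.2 h.T_pos.le)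
  · rw [add_sub_add_right_eq_sub, ← ContinuousLinearMap.sub_comp, mul_comm]
    refine (ContinuousLinearMap.opNorm_comp_le _ _).trans ?_
    gcongr
    exact h.norm_fderiv_f_le _ _ (h.state_mem hv ht)

theorem isCostate_costate (h : P.Regular R M) (hv : P.IsAdmissible v) :
    P.IsCostate v (P.costate v) := by
  have := h.exists_isCostate hv
  rw [costate, dif_pos this]
  exact this.choose_spec

theorem continuous_costate (h : P.Regular R M) (hv : P.IsAdmissible v) :
    Continuous (P.costate v) :=
  (h.isCostate_costate hv).1

/-- Continuity of the integrand of the adjoint equation, mode by mode. -/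
theorem continuousOn_adjoint (h : P.Regular R M) (hv : P.IsAdmissible v) (w : Bool) :
    ContinuousOn (fun s => (P.costate v s).comp (fderiv ℝ (P.f w) (P.state v s)) +
      fderiv ℝ P.L (P.state v s)) (Icc 0 P.T) :=
  ((h.continuous_costate hv).continuousOn.clm_comp
    (h.continuousOn_fderiv_f_state hv w)).add (h.continuousOn_fderiv_L_state hv)

theorem intervalIntegrable_adjoint (h : P.Regular R M) (hv : P.IsAdmissible v) {a b : ℝ}
    (ha : a ∈ Icc 0 P.T) (hb : b ∈ Icc 0 P.T) :
    IntervalIntegrable (fun s => (P.costate v s).comp (fderiv ℝ (P.f (v s)) (P.state v s)) +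
      fderiv ℝ P.L (P.state v s)) volume a b :=
  hv.intervalIntegrable (h.continuousOn_adjoint hv) ha hb

theorem exists_norm_costate_le (h : P.Regular R M) :
    ∃ B, 0 ≤ B ∧ ∀ v, P.IsAdmissible v → ∀ t ∈ Icc 0 P.T, ‖P.costate v t‖ ≤ B := by
  refine ⟨|M * P.T * Real.exp (M * P.T)|, abs_nonneg _, fun v hv t ht => ?_⟩
  have hM := h.M_nonneg
  have hT := h.T_pos
  have hp := (h.continuous_costate hv).norm
  refine (le_mul_exp_of_le_add_mul_integral_right h.T_pos.le hM hp.continuousOn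
    (a := M * P.T) (fun t ht => ?_) t ht).trans ?_
  · rw [(h.isCostate_costate hv).2 t ht]
    have hb : ∀ s ∈ Ioc t P.T, ‖(P.costate v s).comp (fderiv ℝ (P.f (v s)) (P.state v s)) +
        fderiv ℝ P.L (P.state v s)‖ ≤ M + M * ‖P.costate v s‖ := fun s hs => by
      have hm := h.state_mem hv ⟨ht.1.trans hs.1.le, hs.2⟩
      refine (norm_add_le _ _).trans ?_
      rw [add_comm]
      refine add_le_add (h.norm_fderiv_L_le _ hm) ?_
      refine (ContinuousLinearMap.opNorm_comp_le _ _).trans ?_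
      rw [mul_comm]
      gcongr
      exact h.norm_fderiv_f_le _ _ hm
    refine (intervalIntegral.norm_integral_le_of_norm_le ht.2 (ae_of_all _ hb)
      (by apply Continuous.intervalIntegrable; fun_prop)).trans ?_
    rw [intervalIntegral.integral_add (by simp) (by apply Continuous.intervalIntegrable; fun_prop),
      intervalIntegral.integral_const, intervalIntegral.integral_const_mul, smul_eq_mul, mul_comm]
    have : M * (P.T - t) ≤ M * P.T := by gcongr; linarith [ht.1]
    linarith
  · rw [abs_of_nonneg (by positivity)]
    gcongr
    linarith [ht.1]

/-- Uniform continuity of the derivatives, and uniform first-order expansions, on the ball that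
contains the trajectories. -/
theorem exists_modulus (h : P.Regular R M) {ε : ℝ} (hε : 0 < ε) :
    ∃ δ > 0, ∀ x ∈ Metric.closedBall 0 R, ∀ y ∈ Metric.closedBall 0 R, ‖y - x‖ ≤ δ →
      (∀ w, ‖fderiv ℝ (P.f w) y - fderiv ℝ (P.f w) x‖ ≤ ε) ∧
      ‖fderiv ℝ P.L y - fderiv ℝ P.L x‖ ≤ ε ∧
      (∀ w, ‖P.f w y - P.f w x - fderiv ℝ (P.f w) x (y - x)‖ ≤ ε * ‖y - x‖) ∧
      ‖P.L y - P.L x - fderiv ℝ P.L x (y - x)‖ ≤ ε * ‖y - x‖ := by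
  have key : ∀ {F : Type} [NormedAddCommGroup F] [NormedSpace ℝ F]
      (g : EuclideanSpace ℝ (Fin n) → F), ContDiff ℝ 1 g →
      ∃ δ > 0, ∀ x ∈ Metric.closedBall 0 R, ∀ y ∈ Metric.closedBall 0 R, ‖y - x‖ ≤ δ →
        ‖fderiv ℝ g y - fderiv ℝ g x‖ ≤ ε ∧
        ‖g y - g x - fderiv ℝ g x (y - x)‖ ≤ ε * ‖y - x‖ := by
    intro F _ _ g hg
    obtain ⟨δ, hδ, hu⟩ := Metric.uniformContinuousOn_iff.1
      ((isCompact_closedBall (0 : EuclideanSpace ℝ (Fin n)) R).uniformContinuousOn_of_continuous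
        (hg.continuous_fderiv one_ne_zero).continuousOn) ε hε
    have hb : ∀ x ∈ Metric.closedBall (0 : EuclideanSpace ℝ (Fin n)) R,
        ∀ y ∈ Metric.closedBall 0 R, ‖y - x‖ ≤ δ / 2 →
        ‖fderiv ℝ g y - fderiv ℝ g x‖ ≤ ε := fun x hx y hy hxy => by
      rw [← dist_eq_norm]
      exact (hu y hy x hx (by rw [dist_eq_norm]; linarith)).le
    refine ⟨δ / 2, half_pos hδ, fun x hx y hy hxy => ⟨hb x hx y hy hxy, ?_⟩⟩
    refine (convex_segment x y).norm_image_sub_le_of_norm_fderiv_le'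
      (fun z _ => (hg.differentiable one_ne_zero).differentiableAt) (fun z hz => ?_)
      (left_mem_segment ℝ x y) (right_mem_segment ℝ x y)
    refine hb x hx z ((convex_closedBall 0 R).segment_subset hx hy hz) ?_
    exact (norm_sub_le_of_mem_segment hz).trans hxy
  have h1 := fun w => key (P.f w) (h.contDiff_f w)
  choose δ hδ h1 using h1
  obtain ⟨d, hd, h2⟩ := key P.L h.contDiff_L
  refine ⟨min d (min (δ true) (δ false)), lt_min hd (lt_min (hδ _) (hδ _)),
    fun x hx y hy hxy => ?_⟩
  have hle : ∀ w, ‖y - x‖ ≤ δ w := by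
    rintro (_ | _)
    · exact hxy.trans ((min_le_right _ _).trans (min_le_right _ _))
    · exact hxy.trans ((min_le_right _ _).trans (min_le_left _ _))
  have h2' := h2 x hx y hy (hxy.trans (min_le_left _ _))
  exact ⟨fun w => (h1 w x hx y hy (hle w)).1, h2'.1, fun w => (h1 w x hx y hy (hle w)).2, h2'.2⟩

/-- The adjoint integrands differ by a change of mode, which costs 2BM times the measure of the
switch set; by a change of derivatives along nearby trajectories, at most (B + 1)ε₁ by uniform
continuity; and by a term bounded by M‖p' - p‖, which backward Grönwall absorbs. Only a modulus is
obtained, as the derivatives are merely continuous. -/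
theorem exists_norm_costate_sub_le (h : P.Regular R M) {ε : ℝ} (hε : 0 < ε) :
    ∃ δ > 0, ∀ v v', P.IsAdmissible v → P.IsAdmissible v' →
      volume.real (P.switchSet v v') ≤ δ →
      ∀ t ∈ Icc 0 P.T, ‖P.costate v' t - P.costate v t‖ ≤ ε := by
  have hM := h.M_nonneg
  have hT := h.T_pos
  obtain ⟨C, hC, hstate⟩ := h.exists_norm_state_sub_le
  obtain ⟨B, hB, hcostate⟩ := h.exists_norm_costate_le
  obtain ⟨ε₁, hε₁, hε₁'⟩ := exists_pos_mul_lt (half_pos hε)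
    ((B + 1) * P.T * Real.exp (M * P.T))
  obtain ⟨δ₁, hδ₁, hmod⟩ := h.exists_modulus hε₁
  obtain ⟨δ₂, hδ₂, hδ₂'⟩ := exists_pos_mul_lt hδ₁ C
  obtain ⟨δ₃, hδ₃, hδ₃'⟩ := exists_pos_mul_lt (half_pos hε) (2 * B * M * Real.exp (M * P.T))
  refine ⟨min δ₂ δ₃, lt_min hδ₂ hδ₃, fun v v' hv hv' hle t ht => ?_⟩
  set m := volume.real (P.switchSet v v') with hm
  have hm0 : 0 ≤ m := measureReal_nonneg
  have hd : ∀ s ∈ Icc 0 P.T, ‖P.state v' s - P.state v s‖ ≤ δ₁ := fun s hs =>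
    (hstate v v' hv hv' s hs).trans
      ((mul_le_mul_of_nonneg_left (hle.trans (min_le_left _ _)) hC).trans hδ₂'.le)
  have hp := h.continuous_costate hv
  have hp' := h.continuous_costate hv'
  refine (le_mul_exp_of_le_add_mul_integral_right (g := fun t => ‖P.costate v' t - P.costate v t‖)
    h.T_pos.le hM (hp'.sub hp).norm.continuousOn
    (a := (B + 1) * ε₁ * P.T + 2 * B * M * m) (fun t ht => ?_) t ht).trans ?_
  · have hTm := right_mem_Icc.2 hT.le
    have hi1 : IntervalIntegrable (fun s => (P.costate v s).comp
        (fderiv ℝ (P.f (v' s)) (P.state v s))) volume t P.T :=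
      hv'.intervalIntegrable (g := fun w s => (P.costate v s).comp
        (fderiv ℝ (P.f w) (P.state v s))) (fun w => hp.continuousOn.clm_comp
          (h.continuousOn_fderiv_f_state hv w)) ht hTm
    have hi2 : IntervalIntegrable (fun s => (P.costate v s).comp
        (fderiv ℝ (P.f (v s)) (P.state v s))) volume t P.T :=
      hv.intervalIntegrable (g := fun w s => (P.costate v s).comp
        (fderiv ℝ (P.f w) (P.state v s))) (fun w => hp.continuousOn.clm_comp
          (h.continuousOn_fderiv_f_state hv w)) ht hTm
    have hia := h.intervalIntegrable_adjoint hv ht hTm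
    have hia' := h.intervalIntegrable_adjoint hv' ht hTm
    have hsplit : P.costate v' t - P.costate v t =
        (∫ s in t..P.T, (((P.costate v' s).comp (fderiv ℝ (P.f (v' s)) (P.state v' s)) +
            fderiv ℝ P.L (P.state v' s)) -
          ((P.costate v s).comp (fderiv ℝ (P.f (v s)) (P.state v s)) +
            fderiv ℝ P.L (P.state v s)) -
          ((P.costate v s).comp (fderiv ℝ (P.f (v' s)) (P.state v s)) -
            (P.costate v s).comp (fderiv ℝ (P.f (v s)) (P.state v s))))) +
        ∫ s in t..P.T, ((P.costate v s).comp (fderiv ℝ (P.f (v' s)) (P.state v s)) -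
            (P.costate v s).comp (fderiv ℝ (P.f (v s)) (P.state v s))) := by
      rw [intervalIntegral.integral_sub (hia'.sub hia) (hi1.sub hi2),
        intervalIntegral.integral_sub hia' hia, sub_add_cancel,
        ← (h.isCostate_costate hv).2 t ht, ← (h.isCostate_costate hv').2 t ht]
    rw [hsplit]
    have hb1 : ‖∫ s in t..P.T, ((P.costate v s).comp (fderiv ℝ (P.f (v' s)) (P.state v s)) -
        (P.costate v s).comp (fderiv ℝ (P.f (v s)) (P.state v s)))‖ ≤ 2 * B * M * m := by
      refine norm_integral_le_of_eq_zero_off_switchSet hv hv' (by positivity) (fun s hs => ?_)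
        (fun s _ hs => by rw [hs, sub_self]) ht.1 ht.2 le_rfl
      have hs' := Ico_subset_Icc_self hs
      have hmem := h.state_mem hv hs'
      rw [← ContinuousLinearMap.comp_sub]
      refine (ContinuousLinearMap.opNorm_comp_le _ _).trans ?_
      calc _ ≤ B * (M + M) := by
            gcongr
            · exact hcostate v hv s hs'
            · exact (norm_sub_le _ _).trans
                (add_le_add (h.norm_fderiv_f_le _ _ hmem) (h.norm_fderiv_f_le _ _ hmem))
        _ = _ := by ring
    have hb2 : ∀ s ∈ Ioc t P.T,
        ‖((P.costate v' s).comp (fderiv ℝ (P.f (v' s)) (P.state v' s)) +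
            fderiv ℝ P.L (P.state v' s)) -
          ((P.costate v s).comp (fderiv ℝ (P.f (v s)) (P.state v s)) +
            fderiv ℝ P.L (P.state v s)) -
          ((P.costate v s).comp (fderiv ℝ (P.f (v' s)) (P.state v s)) -
            (P.costate v s).comp (fderiv ℝ (P.f (v s)) (P.state v s)))‖ ≤
        (B + 1) * ε₁ + M * ‖P.costate v' s - P.costate v s‖ := fun s hs => by
      have hs' : s ∈ Icc 0 P.T := ⟨ht.1.trans hs.1.le, hs.2⟩
      have hx := h.state_mem hv hs'
      have hx' := h.state_mem hv' hs'
      obtain ⟨hf, hL, -, -⟩ := hmod _ hx _ hx' (hd s hs')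
      have e : ((P.costate v' s).comp (fderiv ℝ (P.f (v' s)) (P.state v' s)) +
            fderiv ℝ P.L (P.state v' s)) -
          ((P.costate v s).comp (fderiv ℝ (P.f (v s)) (P.state v s)) +
            fderiv ℝ P.L (P.state v s)) -
          ((P.costate v s).comp (fderiv ℝ (P.f (v' s)) (P.state v s)) -
            (P.costate v s).comp (fderiv ℝ (P.f (v s)) (P.state v s))) =
          (P.costate v s).comp
            (fderiv ℝ (P.f (v' s)) (P.state v' s) - fderiv ℝ (P.f (v' s)) (P.state v s)) +
          (fderiv ℝ P.L (P.state v' s) - fderiv ℝ P.L (P.state v s)) +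
          (P.costate v' s - P.costate v s).comp (fderiv ℝ (P.f (v' s)) (P.state v' s)) := by
        rw [ContinuousLinearMap.comp_sub, ContinuousLinearMap.sub_comp]
        abel
      rw [e]
      refine (norm_add_le _ _).trans (add_le_add ((norm_add_le _ _).trans ?_) ?_)
      · rw [add_mul, one_mul]
        refine add_le_add ((ContinuousLinearMap.opNorm_comp_le _ _).trans ?_) hL
        gcongr
        · exact hcostate v hv s hs'
        · exact hf _
      · refine (ContinuousLinearMap.opNorm_comp_le _ _).trans ?_
        rw [mul_comm]
        gcongr
        exact h.norm_fderiv_f_le _ _ hx'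
    refine (norm_add_le _ _).trans ((add_le_add
      (intervalIntegral.norm_integral_le_of_norm_le ht.2 (ae_of_all _ hb2)
        (by apply Continuous.intervalIntegrable; fun_prop)) hb1).trans ?_)
    rw [intervalIntegral.integral_add (by simp) (by apply Continuous.intervalIntegrable; fun_prop),
      intervalIntegral.integral_const, intervalIntegral.integral_const_mul, smul_eq_mul]
    have : (P.T - t) * ((B + 1) * ε₁) ≤ P.T * ((B + 1) * ε₁) := by gcongr; linarith [ht.1]
    linarith
  · have h1 : M * (P.T - t) ≤ M * P.T := by gcongr; linarith [ht.1]
    have h2 : 2 * B * M * Real.exp (M * P.T) * m ≤ 2 * B * M * Real.exp (M * P.T) * δ₃ := by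
      gcongr; exact hle.trans (min_le_right _ _)
    calc _ ≤ ((B + 1) * ε₁ * P.T + 2 * B * M * m) * Real.exp (M * P.T) := by gcongr
      _ = (B + 1) * P.T * Real.exp (M * P.T) * ε₁ + 2 * B * M * Real.exp (M * P.T) * m := by ring
      _ ≤ ε := by linarith

/-- The control is constant just to the right of t, so the adjoint integrand is continuous from the
right there; at a switching time only this one-sided derivative is available. -/
theorem hasDerivWithinAt_costate (h : P.Regular R M) (hv : P.IsAdmissible v) {t : ℝ}
    (ht : t ∈ Ico 0 P.T) :
    HasDerivWithinAt (P.costate v) (-((P.costate v t).comp (fderiv ℝ (P.f (v t)) (P.state v t)) +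
      fderiv ℝ P.L (P.state v t))) (Ioi t) t := by
  obtain ⟨r, htr, hrT, hr⟩ := hv.exists_right_const ht
  have ht' := Ico_subset_Icc_self ht
  have hTm := right_mem_Icc.2 h.T_pos.le
  have hi := h.intervalIntegrable_adjoint hv ht' hTm
  have hc : ContinuousWithinAt (fun s => (P.costate v s).comp
      (fderiv ℝ (P.f (v s)) (P.state v s)) + fderiv ℝ P.L (P.state v s)) (Ioi t) t := by
    have h1 := (h.continuousOn_adjoint hv (v t)) t ht'
    have h2 := (h1.mono (Icc_subset_Icc_left ht.1)).mono_of_mem_nhdsWithin (Icc_mem_nhdsGT ht.2)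
    refine h2.congr_of_eventuallyEq ?_ rfl
    filter_upwards [Ioo_mem_nhdsGT htr] with s hs
    rw [hr s ⟨hs.1.le, hs.2⟩]
  have hmeas : StronglyMeasurableAtFilter (fun s => (P.costate v s).comp
      (fderiv ℝ (P.f (v s)) (P.state v s)) + fderiv ℝ P.L (P.state v s)) (𝓝[>] t) volume :=
    ⟨Ioc t P.T, Ioc_mem_nhdsGT ht.2,
      ((intervalIntegrable_iff_integrableOn_Ioc_of_le ht.2.le).1 hi).aestronglyMeasurable⟩
  have hd := intervalIntegral.integral_hasDerivWithinAt_left hi (s := Ici t) (t := Ioi t) hmeas hc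
  refine (hd.mono Ioi_subset_Ici_self).congr_of_eventuallyEq ?_
    ((h.isCostate_costate hv).2 t ht')
  filter_upwards [Ioc_mem_nhdsGT ht.2] with s hs
  exact (h.isCostate_costate hv).2 s ⟨ht.1.trans hs.1.le, hs.2⟩

theorem intervalIntegrable_modeGain (h : P.Regular R M) (hv : P.IsAdmissible v)
    (hv' : P.IsAdmissible v') {a b : ℝ} (ha : a ∈ Icc 0 P.T) (hb : b ∈ Icc 0 P.T) :
    IntervalIntegrable (fun t => P.modeGain v t (v' t)) volume a b := by
  have hp := (h.continuous_costate hv).continuousOn (s := Icc 0 P.T)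
  have hg := fun w => hp.clm_apply (h.continuousOn_f_state hv w)
  simp only [modeGain, map_sub]
  exact (hv'.intervalIntegrable hg ha hb).sub (hv.intervalIntegrable hg ha hb)

/-- First-order expansion of the cost, with an error that is uniformly small compared with the
measure of the set where the controls differ. -/
theorem exists_abs_cost_sub_le (h : P.Regular R M) {ε : ℝ} (hε : 0 < ε) :
    ∃ δ > 0, ∀ v v', P.IsAdmissible v → P.IsAdmissible v' →
      volume.real (P.switchSet v v') ≤ δ →
      |P.cost v' - P.cost v - ∫ t in (0 : ℝ)..P.T, P.modeGain v t (v' t)| ≤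
        ε * volume.real (P.switchSet v v') := by
  have hM := h.M_nonneg
  have hT := h.T_pos
  obtain ⟨C, hC, hstate⟩ := h.exists_norm_state_sub_le
  obtain ⟨B, hB, hcostate⟩ := h.exists_norm_costate_le
  obtain ⟨ε₁, hε₁, hε₁'⟩ := exists_pos_mul_lt (half_pos hε) (C * (1 + B) * P.T)
  obtain ⟨δ₁, hδ₁, hmod⟩ := h.exists_modulus hε₁
  obtain ⟨δ₂, hδ₂, hδ₂'⟩ := exists_pos_mul_lt hδ₁ C
  obtain ⟨δ₃, hδ₃, hδ₃'⟩ := exists_pos_mul_lt (half_pos hε) (2 * B * M * C)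
  refine ⟨min δ₂ δ₃, lt_min hδ₂ hδ₃, fun v v' hv hv' hle => ?_⟩
  have hy := hstate v v' hv hv'
  set m := volume.real (P.switchSet v v') with hm
  have hm0 : 0 ≤ m := measureReal_nonneg
  have hd : ∀ s ∈ Icc 0 P.T, ‖P.state v' s - P.state v s‖ ≤ δ₁ := fun s hs =>
    (hy s hs).trans ((mul_le_mul_of_nonneg_left (hle.trans (min_le_left _ _)) hC).trans hδ₂'.le)
  have h0m := left_mem_Icc.2 hT.le
  have hTm := right_mem_Icc.2 hT.le
  have hpc := (h.continuous_costate hv).continuousOn (s := Icc 0 P.T)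
  have hxc := h.continuousOn_state hv
  have hxc' := h.continuousOn_state hv'
  set p := P.costate v with hp
  set x := P.state v with hx
  set x' := P.state v' with hx'
  have hyc : ContinuousOn (fun t => x' t - x t) (Icc 0 P.T) := hxc'.sub hxc
  have ii : ∀ {g : ℝ → ℝ}, ContinuousOn g (Icc 0 P.T) → IntervalIntegrable g volume 0 P.T :=
    fun hg => ContinuousOn.intervalIntegrable (by rwa [uIcc_of_le hT.le])
  have hLx : IntervalIntegrable (fun t => P.L (x t)) volume 0 P.T :=
    ii (h.contDiff_L.continuous.comp_continuousOn hxc)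
  have hLx' : IntervalIntegrable (fun t => P.L (x' t)) volume 0 P.T :=
    ii (h.contDiff_L.continuous.comp_continuousOn hxc')
  have hDL : IntervalIntegrable (fun t => fderiv ℝ P.L (x t) (x' t - x t)) volume 0 P.T :=
    ii ((h.continuousOn_fderiv_L_state hv).clm_apply hyc)
  have hff : IntervalIntegrable (fun t => p t (P.f (v' t) (x' t))) volume 0 P.T :=
    hv'.intervalIntegrable (fun w => hpc.clm_apply (h.continuousOn_f_state hv' w)) h0m hTm
  have hf' : IntervalIntegrable (fun t => p t (P.f (v' t) (x t))) volume 0 P.T :=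
    hv'.intervalIntegrable (fun w => hpc.clm_apply (h.continuousOn_f_state hv w)) h0m hTm
  have hf : IntervalIntegrable (fun t => p t (P.f (v t) (x t))) volume 0 P.T :=
    hv.intervalIntegrable (fun w => hpc.clm_apply (h.continuousOn_f_state hv w)) h0m hTm
  have hDc := fun w =>
    hpc.clm_apply ((h.continuousOn_fderiv_f_state hv w).clm_apply hyc)
  have hD' : IntervalIntegrable (fun t => p t (fderiv ℝ (P.f (v' t)) (x t) (x' t - x t)))
      volume 0 P.T := hv'.intervalIntegrable hDc h0m hTm
  have hD : IntervalIntegrable (fun t => p t (fderiv ℝ (P.f (v t)) (x t) (x' t - x t)))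
      volume 0 P.T := hv.intervalIntegrable hDc h0m hTm
  -- The function p(x' - x) vanishes at both ends, since p(T) = 0 and both trajectories start at the
  -- same point. The integral of its derivative is therefore 0, which trades the linear term in L
  -- for terms in f.
  have hparts : (∫ t in (0 : ℝ)..P.T, p t (P.f (v' t) (x' t))) -
      (∫ t in (0 : ℝ)..P.T, p t (P.f (v t) (x t))) -
      (∫ t in (0 : ℝ)..P.T, p t (fderiv ℝ (P.f (v t)) (x t) (x' t - x t))) -
      (∫ t in (0 : ℝ)..P.T, fderiv ℝ P.L (x t) (x' t - x t)) = 0 := by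
    rw [← intervalIntegral.integral_sub hff hf, ← intervalIntegral.integral_sub (hff.sub hf) hD,
      ← intervalIntegral.integral_sub ((hff.sub hf).sub hD) hDL]
    have := intervalIntegral.integral_eq_sub_of_hasDeriv_right_of_le (f := fun t => p t (x' t - x t))
      (f' := fun t => p t (P.f (v' t) (x' t)) - p t (P.f (v t) (x t)) -
        p t (fderiv ℝ (P.f (v t)) (x t) (x' t - x t)) - fderiv ℝ P.L (x t) (x' t - x t))
      hT.le (hpc.clm_apply hyc) (fun t ht => ?_) (((hff.sub hf).sub hD).sub hDL)
    · rw [this]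
      have e1 : p P.T = 0 := by rw [hp, (h.isCostate_costate hv).2 _ hTm]; simp
      have e2 : x' 0 - x 0 = 0 := by
        rw [hx, hx', (h.isTrajectory_state hv).2.1, (h.isTrajectory_state hv').2.1, sub_self]
      rw [e1, e2]; simp
    · have ht' := Ioo_subset_Ico_self ht
      have := (h.hasDerivWithinAt_costate hv ht').clm_apply
        ((((h.isTrajectory_state hv').2.2 t ht').sub
          ((h.isTrajectory_state hv).2.2 t ht')).mono Ioi_subset_Ici_self)
      refine this.congr_deriv ?_
      simp only [neg_apply, add_apply,
        ContinuousLinearMap.comp_apply, map_sub, Pi.sub_apply, ← hp, ← hx, ← hx']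
      ring
  -- The error consists of the Taylor remainders of L and f, which are o(m) because ‖x' - x‖ ≤ Cm,
  -- and of the difference between the linearizations in the two modes, which is O(m) and lives on a
  -- set of measure m, hence contributes O(m²).
  have hsplit : P.cost v' - P.cost v - ∫ t in (0 : ℝ)..P.T, P.modeGain v t (v' t) =
      (∫ t in (0 : ℝ)..P.T, ((P.L (x' t) - P.L (x t) - fderiv ℝ P.L (x t) (x' t - x t)) +
        (p t (P.f (v' t) (x' t)) - p t (P.f (v' t) (x t)) -
          p t (fderiv ℝ (P.f (v' t)) (x t) (x' t - x t))))) +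
      ∫ t in (0 : ℝ)..P.T, (p t (fderiv ℝ (P.f (v' t)) (x t) (x' t - x t)) -
        p t (fderiv ℝ (P.f (v t)) (x t) (x' t - x t))) := by
    have hg : ∫ t in (0 : ℝ)..P.T, P.modeGain v t (v' t) =
        (∫ t in (0 : ℝ)..P.T, p t (P.f (v' t) (x t))) -
          ∫ t in (0 : ℝ)..P.T, p t (P.f (v t) (x t)) := by
      rw [← intervalIntegral.integral_sub hf' hf]
      simp only [modeGain, map_sub, ← hp, ← hx]
    rw [intervalIntegral.integral_add ((hLx'.sub hLx).sub hDL) ((hff.sub hf').sub hD'),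
      intervalIntegral.integral_sub (hLx'.sub hLx) hDL, intervalIntegral.integral_sub hLx' hLx,
      intervalIntegral.integral_sub (hff.sub hf') hD', intervalIntegral.integral_sub hff hf',
      intervalIntegral.integral_sub hD' hD, hg]
    simp only [cost, ← hx, ← hx']
    linarith
  rw [hsplit, ← Real.norm_eq_abs]
  have hb1 : ‖∫ t in (0 : ℝ)..P.T, ((P.L (x' t) - P.L (x t) - fderiv ℝ P.L (x t) (x' t - x t)) +
        (p t (P.f (v' t) (x' t)) - p t (P.f (v' t) (x t)) -
          p t (fderiv ℝ (P.f (v' t)) (x t) (x' t - x t))))‖ ≤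
      (ε₁ * (C * m) + B * (ε₁ * (C * m))) * |P.T - 0| := by
    refine intervalIntegral.norm_integral_le_of_norm_le_const fun t ht => ?_
    rw [uIoc_of_le hT.le] at ht
    have ht' := Ioc_subset_Icc_self ht
    obtain ⟨-, -, h1, h2⟩ := hmod _ (h.state_mem hv ht') _ (h.state_mem hv' ht') (hd t ht')
    have hyt := hy t ht'
    rw [← map_sub, ← map_sub]
    refine (norm_add_le _ _).trans (add_le_add (h2.trans ?_)
      ((ContinuousLinearMap.le_opNorm _ _).trans ?_))
    · gcongr
    · gcongr
      · exact hcostate v hv t ht'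
      · exact (h1 _).trans (by gcongr)
  have hb2 : ‖∫ t in (0 : ℝ)..P.T, (p t (fderiv ℝ (P.f (v' t)) (x t) (x' t - x t)) -
        p t (fderiv ℝ (P.f (v t)) (x t) (x' t - x t)))‖ ≤ B * ((M + M) * (C * m)) * m := by
    refine norm_integral_le_of_eq_zero_off_switchSet hv hv' (by positivity) (fun t ht => ?_)
      (fun s _ hs => by rw [hs, sub_self]) le_rfl hT.le le_rfl
    have ht' := Ico_subset_Icc_self ht
    have hmem := h.state_mem hv ht'
    rw [← map_sub, ← sub_apply]
    refine (ContinuousLinearMap.le_opNorm _ _).trans ?_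
    gcongr
    · exact hcostate v hv t ht'
    · refine (ContinuousLinearMap.le_opNorm _ _).trans ?_
      gcongr
      · exact (norm_sub_le _ _).trans
          (add_le_add (h.norm_fderiv_f_le _ _ hmem) (h.norm_fderiv_f_le _ _ hmem))
      · exact hy t ht'
  refine (norm_add_le _ _).trans ((add_le_add hb1 hb2).trans ?_)
  rw [sub_zero, abs_of_pos hT]
  have h2 : 2 * B * M * C * m ≤ 2 * B * M * C * δ₃ := by
    gcongr; exact hle.trans (min_le_right _ _)
  calc _ = (C * (1 + B) * P.T * ε₁ + 2 * B * M * C * m) * m := by ring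
    _ ≤ ε * m := by gcongr; linarith

end Regular

/-! ### Mode gains as insertion gradients -/

theorem modeGain_self (t : ℝ) : P.modeGain v t (v t) = 0 := by simp [modeGain]

theorem integral_indicator_const_of_subset {T : ℝ} (hT : 0 ≤ T) {A : Set ℝ} (hA : MeasurableSet A)
    (hAT : A ⊆ Icc 0 T) (c : ℝ) :
    ∫ t in (0 : ℝ)..T, A.indicator (fun _ => c) t = volume.real A * c := by
  rw [intervalIntegral.integral_of_le hT, ← integral_Icc_eq_integral_Ioc, setIntegral_indicator hA,
    inter_eq_right.2 hAT, setIntegral_const, smul_eq_mul]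

theorem intervalIntegrable_indicator_const {T : ℝ} {A : Set ℝ} (hA : MeasurableSet A)
    (hAT : A ⊆ Icc 0 T) (c : ℝ) :
    IntervalIntegrable (fun t => A.indicator (fun _ => c) t) volume 0 T :=
  ((integrable_indicator_iff hA).2 (integrableOn_const
    (measure_ne_top_of_subset hAT measure_Icc_lt_top.ne))).intervalIntegrable

theorem insertMode_zero (s : ℝ) (w : Bool) : insertMode v s 0 w = v := by
  funext t
  simp [insertMode]

namespace Regular

theorem exists_abs_modeGain_le (h : P.Regular R M) :
    ∃ K, 0 ≤ K ∧ ∀ v, P.IsAdmissible v → ∀ t ∈ Icc 0 P.T, ∀ w, |P.modeGain v t w| ≤ K := by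
  have hM := h.M_nonneg
  obtain ⟨B, hB, hcostate⟩ := h.exists_norm_costate_le
  refine ⟨B * (M + M), by positivity, fun v hv t ht w => ?_⟩
  have hx := h.state_mem hv ht
  refine ((P.costate v t).le_opNorm (P.f w (P.state v t) - P.f (v t) (P.state v t))).trans ?_
  gcongr
  · exact hcostate v hv t ht
  · exact (norm_sub_le _ _).trans (add_le_add (h.norm_f_le _ _ hx) (h.norm_f_le _ _ hx))

/-- The pair of modes is held fixed because `modeGain` itself refers to the current mode and so
jumps wherever a flip occurs; with the modes frozen, the expression is stable uniformly in time. -/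
theorem exists_abs_gain_sub_le (h : P.Regular R M) {ε : ℝ} (hε : 0 < ε) :
    ∃ δ > 0, ∀ v v', P.IsAdmissible v → P.IsAdmissible v' →
      volume.real (P.switchSet v v') ≤ δ → ∀ t ∈ Icc 0 P.T, ∀ u w,
      |P.costate v' t (P.f u (P.state v' t) - P.f w (P.state v' t)) -
        P.costate v t (P.f u (P.state v t) - P.f w (P.state v t))| ≤ ε := by
  have hM := h.M_nonneg
  obtain ⟨C, hC, hstate⟩ := h.exists_norm_state_sub_le
  obtain ⟨B, hB, hcostate⟩ := h.exists_norm_costate_le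
  obtain ⟨ε₁, hε₁, hε₁'⟩ := exists_pos_mul_lt (half_pos hε) (M + M)
  obtain ⟨δ₁, hδ₁, hp⟩ := h.exists_norm_costate_sub_le hε₁
  obtain ⟨δ₂, hδ₂, hδ₂'⟩ := exists_pos_mul_lt (half_pos hε) (B * (M * C + M * C))
  refine ⟨min δ₁ δ₂, lt_min hδ₁ hδ₂, fun v v' hv hv' hle t ht u w => ?_⟩
  have hx := h.state_mem hv ht
  have hx' := h.state_mem hv' ht
  have hy := hstate v v' hv hv' t ht
  have e : P.costate v' t (P.f u (P.state v' t) - P.f w (P.state v' t)) -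
        P.costate v t (P.f u (P.state v t) - P.f w (P.state v t)) =
      (P.costate v' t - P.costate v t) (P.f u (P.state v' t) - P.f w (P.state v' t)) +
      P.costate v t ((P.f u (P.state v' t) - P.f u (P.state v t)) -
        (P.f w (P.state v' t) - P.f w (P.state v t))) := by
    simp only [map_sub, sub_apply]
    ring
  rw [e, ← Real.norm_eq_abs]
  have h1 : ‖(P.costate v' t - P.costate v t) (P.f u (P.state v' t) - P.f w (P.state v' t))‖ ≤
      ε₁ * (M + M) := by
    refine (ContinuousLinearMap.le_opNorm _ _).trans ?_
    gcongr
    · exact hp v v' hv hv' (hle.trans (min_le_left _ _)) t ht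
    · exact (norm_sub_le _ _).trans (add_le_add (h.norm_f_le _ _ hx') (h.norm_f_le _ _ hx'))
  have h2 : ‖P.costate v t ((P.f u (P.state v' t) - P.f u (P.state v t)) -
        (P.f w (P.state v' t) - P.f w (P.state v t)))‖ ≤ B * (M * (C * δ₂) + M * (C * δ₂)) := by
    have hδ : ‖P.state v' t - P.state v t‖ ≤ C * δ₂ :=
      hy.trans (by gcongr; exact hle.trans (min_le_right _ _))
    refine (ContinuousLinearMap.le_opNorm _ _).trans ?_
    gcongr
    · exact hcostate v hv t ht
    · refine (norm_sub_le _ _).trans (add_le_add ?_ ?_)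
      · exact (h.norm_f_sub_le _ hx hx').trans (by gcongr)
      · exact (h.norm_f_sub_le _ hx hx').trans (by gcongr)
  refine (norm_add_le _ _).trans ((add_le_add h1 h2).trans ?_)
  linarith

/-- Right-continuity of the gain, together with constancy of the control. It turns information at
one time into information on an interval of positive measure. -/
theorem eventually_modeGain (h : P.Regular R M) (hv : P.IsAdmissible v) {s : ℝ}
    (hs : s ∈ Ico 0 P.T) (w : Bool) {U : Set ℝ} (hU : U ∈ 𝓝 (P.modeGain v s w)) :
    ∃ r, s < r ∧ r ≤ P.T ∧ ∀ t ∈ Ico s r, v t = v s ∧ P.modeGain v t w ∈ U := by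
  obtain ⟨r₁, hsr, hrT, hr⟩ := hv.exists_right_const hs
  have hc : ContinuousOn (fun t => P.costate v t
      (P.f w (P.state v t) - P.f (v s) (P.state v t))) (Icc 0 P.T) :=
    (h.continuous_costate hv).continuousOn.clm_apply
      ((h.continuousOn_f_state hv w).sub (h.continuousOn_f_state hv (v s)))
  have hm := ((hc s (Ico_subset_Icc_self hs)).mono
    (Icc_subset_Icc_left hs.1)).mono_of_mem_nhdsWithin (Icc_mem_nhdsGE hs.2) hU
  obtain ⟨r₂, hr₂, hsub⟩ := mem_nhdsGE_iff_exists_Ico_subset.1 hm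
  refine ⟨min r₁ r₂, lt_min hsr hr₂, (min_le_left _ _).trans hrT, fun t ht => ?_⟩
  have hvt := hr t ⟨ht.1, ht.2.trans_le (min_le_left _ _)⟩
  refine ⟨hvt, ?_⟩
  rw [modeGain, hvt]
  exact hsub ⟨ht.1, ht.2.trans_le (min_le_right _ _)⟩

/-- An insertion alters the control on at most [s, s + γ), so the expansion has error o(γ), and
right-continuity of the gain makes its integral γ times the gain at s, up to o(γ). -/
theorem hasDerivWithinAt_cost_insertMode (h : P.Regular R M) (hv : P.IsAdmissible v) {s : ℝ}
    (hs : s ∈ Ico 0 P.T) (w : Bool) :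
    HasDerivWithinAt (fun γ => P.cost (insertMode v s γ w)) (P.modeGain v s w) (Ici 0) 0 := by
  rw [hasDerivWithinAt_iff_isLittleO, Asymptotics.isLittleO_iff]
  intro c hc
  obtain ⟨δ, hδ, hexp⟩ := h.exists_abs_cost_sub_le (half_pos hc)
  obtain ⟨r, hsr, hrT, hr⟩ := h.eventually_modeGain hv hs w
    (Metric.closedBall_mem_nhds (P.modeGain v s w) (half_pos hc))
  filter_upwards [Icc_mem_nhdsGE (lt_min hδ (sub_pos.2 hsr))] with γ hγ
  have hγδ := hγ.2.trans (min_le_left _ _)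
  have hγr : s + γ ≤ r := by linarith [hγ.2.trans (min_le_right _ _)]
  have hadm := hv.insertMode h.T_pos s γ w
  have hset : P.switchSet v (insertMode v s γ w) ⊆ Ico s (s + γ) := fun t ht => by
    by_contra hn
    exact ht.2 (if_neg hn).symm
  have hIT : Ico s (s + γ) ⊆ Icc 0 P.T := fun t ht =>
    ⟨hs.1.trans ht.1, ht.2.le.trans (hγr.trans hrT)⟩
  have hvol : volume.real (Ico s (s + γ)) = γ := by
    rw [Real.volume_real_Ico_of_le (by linarith [hγ.1])]; ring
  have hm : volume.real (P.switchSet v (insertMode v s γ w)) ≤ γ :=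
    (measureReal_mono hset measure_Ico_lt_top.ne).trans_eq hvol
  have h1 := hexp v _ hv hadm (hm.trans hγδ)
  have hi := h.intervalIntegrable_modeGain hv hadm (left_mem_Icc.2 h.T_pos.le)
    (right_mem_Icc.2 h.T_pos.le)
  have hiG := intervalIntegrable_indicator_const (T := P.T) measurableSet_Ico hIT
    (P.modeGain v s w)
  have h2 : |(∫ t in (0 : ℝ)..P.T, P.modeGain v t (insertMode v s γ w t)) -
      γ * P.modeGain v s w| ≤ γ * (c / 2) := by
    have e1 := integral_indicator_const_of_subset h.T_pos.le measurableSet_Ico hIT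
      (P.modeGain v s w)
    have e2 := integral_indicator_const_of_subset h.T_pos.le measurableSet_Ico hIT (c / 2)
    rw [hvol] at e1 e2
    rw [← e1, ← e2, ← intervalIntegral.integral_sub hi hiG, ← Real.norm_eq_abs]
    refine intervalIntegral.norm_integral_le_of_norm_le h.T_pos.le (ae_of_all _ fun t _ => ?_)
      (intervalIntegrable_indicator_const measurableSet_Ico hIT _)
    by_cases ht : t ∈ Ico s (s + γ)
    · rw [indicator_of_mem ht, indicator_of_mem ht, ← dist_eq_norm, insertMode, if_pos ht]
      exact (hr t ⟨ht.1, ht.2.trans_le hγr⟩).2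
    · rw [indicator_of_notMem ht, indicator_of_notMem ht, insertMode, if_neg ht, modeGain_self]
      simp
  simp only [insertMode_zero, sub_zero, smul_eq_mul]
  rw [Real.norm_eq_abs, Real.norm_eq_abs, abs_of_nonneg hγ.1]
  have h3 : c / 2 * volume.real (P.switchSet v (insertMode v s γ w)) ≤ c / 2 * γ := by gcongr
  calc _ = |(P.cost (insertMode v s γ w) - P.cost v -
          ∫ t in (0 : ℝ)..P.T, P.modeGain v t (insertMode v s γ w t)) +
        ((∫ t in (0 : ℝ)..P.T, P.modeGain v t (insertMode v s γ w t)) -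
          γ * P.modeGain v s w)| := by congr 1; ring
    _ ≤ c / 2 * γ + γ * (c / 2) := (abs_add_le _ _).trans (add_le_add (h1.trans h3) h2)
    _ = c * γ := by ring

theorem insertionGradient_eq (h : P.Regular R M) (hv : P.IsAdmissible v) {s : ℝ}
    (hs : s ∈ Ico 0 P.T) (w : Bool) : P.insertionGradient v s w = P.modeGain v s w :=
  (h.hasDerivWithinAt_cost_insertMode hv hs w).derivWithin (uniqueDiffOn_Ici 0 0 self_mem_Ici)

theorem insertionGradient_T (h : P.Regular R M) (hv : P.IsAdmissible v) (w : Bool) :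
    P.insertionGradient v P.T w = 0 := by
  have : (fun γ => P.cost (insertMode v P.T γ w)) = fun _ => P.cost v := by
    funext γ
    refine (h.cost_eq hv fun t ht => ?_).symm
    rw [insertMode, if_neg fun htm => not_lt.2 htm.1 ht.2]
  rw [insertionGradient, this]
  simp

/-- One of the two modes is the current one, whose gain is 0. -/
theorem gradAt_eq (h : P.Regular R M) (hv : P.IsAdmissible v) {s : ℝ} (hs : s ∈ Ico 0 P.T) :
    P.gradAt v s = min 0 (P.modeGain v s (!v s)) := by
  have h0 := modeGain_self (P := P) (v := v) s
  rw [gradAt, h.insertionGradient_eq hv hs, h.insertionGradient_eq hv hs]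
  rcases hvs : v s with _ | _ <;> rw [hvs] at h0 <;> rw [h0]
  · rfl
  · exact min_comm _ _

theorem gradAt_T (h : P.Regular R M) (hv : P.IsAdmissible v) : P.gradAt v P.T = 0 := by
  rw [gradAt, h.insertionGradient_T hv, h.insertionGradient_T hv, min_self]

theorem bddBelow_gradAt (h : P.Regular R M) (hv : P.IsAdmissible v) :
    BddBelow (P.gradAt v '' Icc 0 P.T) := by
  obtain ⟨K, hK, hb⟩ := h.exists_abs_modeGain_le
  refine ⟨-K, ?_⟩
  rintro _ ⟨s, hs, rfl⟩
  rcases hs.2.eq_or_lt with rfl | hlt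
  · rw [h.gradAt_T hv]; linarith
  · rw [h.gradAt_eq hv ⟨hs.1, hlt⟩]
    exact le_min (by linarith) (abs_le.1 (hb v hv s hs _)).1

theorem optFun_nonpos (h : P.Regular R M) (hv : P.IsAdmissible v) : P.optFun v ≤ 0 :=
  (csInf_le (h.bddBelow_gradAt hv) ⟨P.T, right_mem_Icc.2 h.T_pos.le, rfl⟩).trans_eq
    (h.gradAt_T hv)

theorem le_optFun (h : P.Regular R M) (hv : P.IsAdmissible v) {c : ℝ} (hc : c ≤ 0)
    (hgain : ∀ s ∈ Ico 0 P.T, c ≤ P.modeGain v s (!v s)) : c ≤ P.optFun v := by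
  refine le_csInf ⟨_, P.T, right_mem_Icc.2 h.T_pos.le, rfl⟩ ?_
  rintro _ ⟨s, hs, rfl⟩
  rcases hs.2.eq_or_lt with rfl | hlt
  · rw [h.gradAt_T hv]; exact hc
  · rw [h.gradAt_eq hv ⟨hs.1, hlt⟩]
    exact le_min hc (hgain s ⟨hs.1, hlt⟩)

end Regular

/-! ### Flipping on the descent set: sufficient decrease and contraction -/

/-- Flipping looks at A just to the right of t, which agrees with membership of t except on the
finite frontier of A. -/
theorem switchSet_flip_ae_eq {A : Set ℝ} (hA : IsFiniteUnionOfIntervals A) (hAT : A ⊆ Icc 0 P.T) :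
    P.switchSet v (flip v A) =ᵐ[volume] A := by
  have h0 : ∀ᵐ t : ℝ, t ∉ frontier A ∪ {P.T} :=
    compl_mem_ae_iff.2 ((hA.finite_frontier.union (finite_singleton _)).measure_zero _)
  filter_upwards [h0] with t ht
  have ht1 : t ∉ frontier A := fun h => ht (Or.inl h)
  have ht2 : t ≠ P.T := fun h => ht (Or.inr h)
  have hiff := mem_nhdsGT_iff_of_notMem_frontier ht1
  refine propext ⟨fun h => ?_, fun h => ⟨⟨(hAT h).1, lt_of_le_of_ne (hAT h).2 ht2⟩, ?_⟩⟩
  · by_contra hn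
    exact h.2 (if_neg fun hm => hn (hiff.1 hm)).symm
  · rw [flip, if_pos (hiff.2 h)]
    exact (Bool.not_ne_self _).symm

theorem flip_eq_of_notMem_switchSet {A : Set ℝ} {t : ℝ} (ht : t ∈ Ico 0 P.T)
    (h : t ∉ P.switchSet v (flip v A)) : flip v A t = v t := by
  by_contra hn
  exact h ⟨ht, fun e => hn e.symm⟩

theorem flip_eq_of_mem_switchSet {A : Set ℝ} {t : ℝ}
    (h : t ∈ P.switchSet v (flip v A)) : flip v A t = !v t :=
  Bool.eq_not.2 (Ne.symm h.2)

theorem descentSet_subset {η : ℝ} : P.descentSet η v ⊆ Icc 0 P.T := fun _ h => h.1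

namespace Regular

/-- Flipping the mode on a small set of times of sufficient descent passes the Armijo test. -/
theorem exists_cost_flip_sub_le (h : P.Regular R M) {α η ε : ℝ} (hη : 0 < η) (hαη : α < η)
    (hε : 0 < ε) :
    ∃ δ > 0, ∀ v, P.IsAdmissible v → P.optFun v ≤ -ε → ∀ A, IsFiniteUnionOfIntervals A →
      A ⊆ P.descentSet η v → volume.real A ≤ δ →
      P.cost (flip v A) - P.cost v ≤ α * volume.real A * P.optFun v := by
  -- The tolerance (η - α)ε is the slack: the linear term gives ηD μ(A), the test asks only for αD
  -- μ(A), and D ≤ -ε.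
  obtain ⟨δ, hδ, hexp⟩ := h.exists_abs_cost_sub_le (mul_pos (sub_pos.2 hαη) hε)
  refine ⟨δ, hδ, fun v hv hD A hA hAS hle => ?_⟩
  have hAT := hAS.trans descentSet_subset
  have hadm := hv.flip h.T_pos hA
  have hae := switchSet_flip_ae_eq (P := P) (v := v) hA hAT
  have hvol : volume.real (P.switchSet v (flip v A)) = volume.real A := measureReal_congr hae
  have h1 := hexp v _ hv hadm (hvol.trans_le hle)
  rw [hvol] at h1
  have h2 : ∫ t in (0 : ℝ)..P.T, P.modeGain v t (flip v A t) ≤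
      volume.real A * (η * P.optFun v) := by
    rw [← integral_indicator_const_of_subset h.T_pos.le hA.measurableSet hAT]
    refine intervalIntegral.integral_mono_ae_restrict h.T_pos.le
      (h.intervalIntegrable_modeGain hv hadm (left_mem_Icc.2 h.T_pos.le)
        (right_mem_Icc.2 h.T_pos.le))
      (intervalIntegrable_indicator_const hA.measurableSet hAT _) ?_
    rw [EventuallyLE, ae_restrict_iff' measurableSet_Icc]
    have hT : ∀ᵐ t : ℝ, t ≠ P.T := compl_mem_ae_iff.2 (measure_singleton _)
    filter_upwards [hae, hT] with t ht htT htI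
    have htI' : t ∈ Ico 0 P.T := ⟨htI.1, lt_of_le_of_ne htI.2 htT⟩
    by_cases hmem : t ∈ A
    · have hS := (hAS hmem).2
      rw [h.gradAt_eq hv htI'] at hS
      rw [indicator_of_mem hmem, flip_eq_of_mem_switchSet ((iff_of_eq ht).2 hmem)]
      have : η * P.optFun v < 0 := mul_neg_of_pos_of_neg hη (by linarith)
      rcases min_le_iff.1 hS with h0 | h0
      · linarith
      · exact h0
    · rw [indicator_of_notMem hmem,
        flip_eq_of_notMem_switchSet htI' fun hs => hmem ((iff_of_eq ht).1 hs), modeGain_self]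
  have h3 := (abs_le.1 h1).2
  have h4 := mul_nonneg (measureReal_nonneg (μ := volume) (s := A))
    (mul_nonneg (sub_pos.2 hαη).le (by linarith : (0 : ℝ) ≤ -ε - P.optFun v))
  nlinarith

/-- After a small step that flips almost all times of sufficient descent, the optimality function
has shrunk by the factor `η`, up to a small error. -/
theorem exists_mul_optFun_sub_le (h : P.Regular R M) {η ε : ℝ} (hη : 0 < η) (hε : 0 < ε) :
    ∃ δ > 0, ∀ v, P.IsAdmissible v → P.optFun v < 0 → ∀ A, IsFiniteUnionOfIntervals A →
      A ⊆ P.descentSet η v → volume (P.descentSet η v) ≤ volume A → volume.real A ≤ δ →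
      η * P.optFun v - ε ≤ P.optFun (flip v A) := by
  obtain ⟨δ, hδ, hgain⟩ := h.exists_abs_gain_sub_le hε
  refine ⟨δ, hδ, fun v hv hD A hA hAS hfull hle => ?_⟩
  have hAT := hAS.trans descentSet_subset
  have hadm := hv.flip h.T_pos hA
  have hae := switchSet_flip_ae_eq (P := P) (v := v) hA hAT
  have hvol : volume.real (P.switchSet v (flip v A)) = volume.real A := measureReal_congr hae
  have hηD : η * P.optFun v < 0 := mul_neg_of_pos_of_neg hη hD
  -- Measurability of A alone suffices for this, so none is needed for the descent set.
  have hAS' : A =ᵐ[volume] P.descentSet η v :=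
    ae_eq_of_subset_of_measure_ge hAS hfull hA.measurableSet.nullMeasurableSet
      (measure_ne_top_of_subset descentSet_subset measure_Icc_lt_top.ne)
  have hgv := hgain v _ hv hadm (hvol.trans_le hle)
  refine h.le_optFun hadm (by linarith) fun s hs => ?_
  by_contra! hlt
  obtain ⟨r, hsr, hrT, hr⟩ := h.eventually_modeGain hadm hs _ (Iio_mem_nhds hlt)
  -- The violation at s persists on [s, r), which is not null, so it also occurs at a time t where
  -- being flipped and being in the descent set agree. The time s itself could be exceptional.
  obtain ⟨t, htI, ht⟩ : ∃ t ∈ Ico s r, (t ∈ P.switchSet v (flip v A) ↔ t ∈ P.descentSet η v) := by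
    by_contra hn
    have h0 : volume (Ico s r) = 0 :=
      measure_mono_null (fun t ht he => hn ⟨t, ht, iff_of_eq he⟩) (hae.trans hAS')
    rw [Real.volume_Ico, ENNReal.ofReal_eq_zero] at h0
    linarith
  obtain ⟨hvt, hGt⟩ := hr t htI
  have htT : t ∈ Ico 0 P.T := ⟨hs.1.trans htI.1, htI.2.trans_le hrT⟩
  have htT' := Ico_subset_Icc_self htT
  rw [← hvt, mem_Iio, modeGain] at hGt
  -- If t was flipped, the old gain was at most ηD and has changed sign, so the new one is at least
  -- -ηD - ε. Otherwise t is outside the descent set, the old gain exceeded ηD, and it moved by at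
  -- most ε.
  by_cases hmem : t ∈ P.switchSet v (flip v A)
  · have h1 := (ht.1 hmem).2
    rw [h.gradAt_eq hv htT, modeGain] at h1
    rw [flip_eq_of_mem_switchSet hmem, Bool.not_not] at hGt
    have h2 := (abs_le.1 (hgv t htT' (v t) (!v t))).1
    have h3 : P.costate v t (P.f (v t) (P.state v t) - P.f (!v t) (P.state v t)) =
      -P.costate v t (P.f (!v t) (P.state v t) - P.f (v t) (P.state v t)) := by
      rw [← map_neg, neg_sub]
    rcases min_le_iff.1 h1 with h1 | h1 <;> linarith
  · have h1 : η * P.optFun v < P.gradAt v t := by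
      by_contra! hle
      exact hmem (ht.2 ⟨htT', hle⟩)
    rw [h.gradAt_eq hv htT, modeGain] at h1
    rw [flip_eq_of_notMem_switchSet htT hmem] at hGt
    have h2 := (abs_le.1 (hgv t htT' (!v t) (v t))).1
    have h3 := (lt_min_iff.1 h1).2
    linarith

end Regular

/-! ### The Armijo search and infinite runs -/

variable {α β η : ℝ} {S : ℝ → Set ℝ}

theorem trialStep_mem (hβ : 0 < β) (hβ1 : β < 1) (j : ℕ) :
    P.trialStep β η v j ∈ Icc 0 (volume.real (P.descentSet η v)) :=
  ⟨mul_nonneg (pow_nonneg hβ.le _) measureReal_nonneg,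
    mul_le_of_le_one_left measureReal_nonneg (pow_le_one₀ hβ.le hβ1.le)⟩

theorem IsSelection.volume_real_eq (hS : P.IsSelection η v S) {γ : ℝ}
    (hγ : γ ∈ Icc 0 (volume.real (P.descentSet η v))) : volume.real (S γ) = γ := by
  rw [measureReal_def, (hS γ hγ).2.2, ENNReal.toReal_ofReal hγ.1]

theorem IsStep.isAdmissible (hT : 0 < P.T) (hβ : 0 < β) (hβ1 : β < 1)
    (hs : P.IsStep α β η S v v') (hv : P.IsAdmissible v) : P.IsAdmissible v' := by
  obtain ⟨-, hS, j, -, rfl⟩ := hs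
  exact hv.flip hT (hS _ (trialStep_mem hβ hβ1 j)).2.1

namespace Regular

/-- The Armijo test is passed by all small trial steps, uniformly in the schedule. -/
theorem exists_mem_armijoIndices (h : P.Regular R M) (hη : 0 < η) (hαη : α < η) (hβ : 0 < β)
    (hβ1 : β < 1) {ε : ℝ} (hε : 0 < ε) :
    ∃ δ > 0, ∀ v S, P.IsAdmissible v → P.optFun v ≤ -ε → P.IsSelection η v S →
      ∀ j, P.trialStep β η v j ≤ δ → j ∈ P.armijoIndices α β η v S := by
  obtain ⟨δ, hδ, hdesc⟩ := h.exists_cost_flip_sub_le hη hαη hε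
  refine ⟨δ, hδ, fun v S hv hD hS j hj => ?_⟩
  have hmem := trialStep_mem (P := P) (η := η) (v := v) hβ hβ1 j
  have hvol := hS.volume_real_eq hmem
  have := hdesc v hv hD _ (hS _ hmem).2.1 (hS _ hmem).1 (hvol.trans_le hj)
  rwa [hvol] at this

/-- The line search terminates: the trial steps tend to 0 and fall below the uniform threshold for
the tolerance -D_σ. -/
theorem exists_isStep (h : P.Regular R M) (hη : 0 < η) (hαη : α < η) (hβ : 0 < β)
    (hβ1 : β < 1) (hv : P.IsAdmissible v) (hD : P.optFun v < 0) (hS : P.IsSelection η v S) :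
    ∃ v', P.IsStep α β η S v v' := by
  obtain ⟨δ, hδ, hA⟩ := h.exists_mem_armijoIndices hη hαη hβ hβ1 (neg_pos.2 hD)
  have hlim : Tendsto (fun j => P.trialStep β η v j) atTop (𝓝 0) := by
    have := (tendsto_pow_atTop_nhds_zero_of_lt_one hβ.le hβ1).mul_const
      (volume.real (P.descentSet η v))
    rwa [zero_mul] at this
  obtain ⟨j, hj⟩ := (hlim.eventually (ge_mem_nhds hδ)).exists
  have hne : (P.armijoIndices α β η v S).Nonempty := ⟨j, hA v S hv (neg_neg _).ge hS j hj⟩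
  exact ⟨_, hD.ne, hS, _, ⟨Nat.sInf_mem hne, fun i hi => Nat.sInf_le hi⟩, rfl⟩

/-- Along an infinite run, the optimality function is frequently close to `0`. -/
theorem frequently_neg_lt_optFun (h : P.Regular R M) (hα : 0 < α) (hαη : α < η) (hη : η < 1)
    (hβ : 0 < β) (hβ1 : β < 1) {σ : ℕ → ℝ → Bool} {S : ℕ → ℝ → Set ℝ}
    (hadm : ∀ k, P.IsAdmissible (σ k))
    (hstep : ∀ k, P.IsStep α β η (S k) (σ k) (σ (k + 1))) {ε : ℝ} (hε : 0 < ε) :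
    ∃ᶠ k in atTop, -ε < P.optFun (σ k) := by
  have hη0 := hα.trans hαη
  intro hev
  have hD : ∀ᶠ k in atTop, P.optFun (σ k) ≤ -ε := hev.mono fun k hk => not_lt.1 hk
  choose _ hsel j hj hσ using hstep
  set l : ℕ → ℝ := fun k => P.trialStep β η (σ k) (j k) with hl
  have hlmem : ∀ k, l k ∈ Icc 0 (volume.real (P.descentSet η (σ k))) := fun k =>
    trialStep_mem hβ hβ1 _
  have hcost : ∀ k, P.cost (σ (k + 1)) - P.cost (σ k) ≤ α * l k * P.optFun (σ k) := fun k => by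
    rw [hσ k]; exact (hj k).1
  have hanti : Antitone fun k => P.cost (σ k) := antitone_nat_of_succ_le fun k => by
    have := mul_nonpos_of_nonneg_of_nonpos (mul_nonneg hα.le (hlmem k).1)
      (h.optFun_nonpos (hadm k))
    linarith [hcost k]
  have hbdd : BddBelow (range fun k => P.cost (σ k)) :=
    ⟨-(M * P.T), by rintro _ ⟨k, rfl⟩; exact (abs_le.1 (h.abs_cost_le (hadm k))).1⟩
  have hconv := tendsto_atTop_ciInf hanti hbdd
  -- As D ≤ -ε, each step lowers the cost by at least αε times its length; this quotient therefore
  -- bounds the step length.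
  have hdiff : Tendsto (fun k => (P.cost (σ k) - P.cost (σ (k + 1))) / (α * ε)) atTop (𝓝 0) := by
    have := (hconv.sub (hconv.comp (tendsto_add_atTop_nat 1))).div_const (α * ε)
    rwa [sub_self, zero_div] at this
  have hl0 : Tendsto l atTop (𝓝 0) := by
    refine tendsto_of_tendsto_of_tendsto_of_le_of_le' tendsto_const_nhds hdiff
      (Eventually.of_forall fun k => (hlmem k).1) (hD.mono fun k hk => ?_)
    rw [le_div_iff₀ (mul_pos hα hε)]
    have := mul_le_mul_of_nonneg_left hk (mul_nonneg hα.le (hlmem k).1)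
    linarith [hcost k]
  obtain ⟨δ₁, hδ₁, hA⟩ := h.exists_mem_armijoIndices hη0 hαη hβ hβ1 hε
  -- This error makes -ε/2 the fixed point of D ↦ ηD - (1 - η)ε/2, so the iteration is driven above
  -- -ε.
  have hε' : 0 < (1 - η) * (ε / 2) := mul_pos (sub_pos.2 hη) (half_pos hε)
  obtain ⟨δ₂, hδ₂, hF⟩ := h.exists_mul_optFun_sub_le hη0 hε'
  have hsucc : ∀ᶠ k in atTop,
      η * P.optFun (σ k) - (1 - η) * (ε / 2) ≤ P.optFun (σ (k + 1)) := by
    filter_upwards [hD, hl0.eventually (ge_mem_nhds (mul_pos hβ hδ₁)),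
      hl0.eventually (ge_mem_nhds hδ₂)] with k hk hk₁ hk₂
    -- Otherwise the preceding trial step, longer by the factor 1/β, would still be at most δ₁ and
    -- pass the test, against minimality of j.
    have hj0 : j k = 0 := by
      by_contra hne
      obtain ⟨i, hi⟩ := Nat.exists_eq_succ_of_ne_zero hne
      have hle : P.trialStep β η (σ k) i ≤ δ₁ := by
        refine le_of_mul_le_mul_left ?_ hβ
        refine le_trans (le_of_eq ?_) hk₁
        rw [hl]
        simp only [trialStep, hi, pow_succ]
        ring
      have := (hj k).2 (hA _ _ (hadm k) hk (hsel k) i hle)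
      omega
    have hlk : l k = volume.real (P.descentSet η (σ k)) := by simp [hl, hj0, trialStep]
    have hs := hsel k _ (hlmem k)
    rw [hσ k]
    refine hF _ (hadm k) (by linarith) _ hs.2.1 hs.1 ?_
      (((hsel k).volume_real_eq (hlmem k)).trans_le hk₂)
    refine le_of_eq ?_
    change _ = volume (S k (l k))
    rw [hs.2.2, hlk, ofReal_measureReal
      (measure_ne_top_of_subset descentSet_subset measure_Icc_lt_top.ne)]
  obtain ⟨K, hK⟩ := eventually_atTop.1 (hsucc.and hD)
  have hgeom : ∀ m, -(P.optFun (σ (K + m))) - ε / 2 ≤ η ^ m * (-(P.optFun (σ K)) - ε / 2) := by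
    intro m
    induction m with
    | zero => simp
    | succ m ih =>
      have h1 := (hK (K + m) (Nat.le_add_right _ _)).1
      have h2 := mul_le_mul_of_nonneg_left ih hη0.le
      rw [pow_succ, ← add_assoc]
      linarith
  have hlim : Tendsto (fun m => η ^ m * (-(P.optFun (σ K)) - ε / 2)) atTop (𝓝 0) := by
    have := (tendsto_pow_atTop_nhds_zero_of_lt_one hη0.le hη).mul_const
      (-(P.optFun (σ K)) - ε / 2)
    rwa [zero_mul] at this
  obtain ⟨m, hm⟩ := (hlim.eventually (gt_mem_nhds (half_pos hε))).exists
  linarith [hgeom m, (hK (K + m) (Nat.le_add_right _ _)).2]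

end Regular

end SwitchedSystem

/-! ### The convergence theorem -/

theorem corollary3 {n : ℕ} (P : SwitchedSystem n) (hT : 0 < P.T)
    (hf : ∀ w, ContDiff ℝ 2 (P.f w)) (hL : ContDiff ℝ 1 P.L)
    (hx : ∃ R : ℝ, ∀ v, P.IsAdmissible v →
      ∃ x, P.IsTrajectory v x ∧ ∀ t ∈ Set.Icc 0 P.T, ‖x t‖ ≤ R)
    (α β η : ℝ) (hα : 0 < α) (hαη : α < η) (hη : η < 1) (hβ : 0 < β) (hβ1 : β < 1) :
    -- every infinite run
    (∀ (σ : ℕ → ℝ → Bool) (S : ℕ → ℝ → Set ℝ), P.IsAdmissible (σ 0) →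
      (∀ k, P.IsStep α β η (S k) (σ k) (σ (k + 1))) →
        (∀ k, P.IsAdmissible (σ k)) ∧
        Filter.limsup (fun k => ((P.optFun (σ k) : ℝ) : EReal)) Filter.atTop = 0 ∧
        ∀ ε > 0, ∃ k, -ε < P.optFun (σ k)) ∧
    -- from every initial schedule, finitely many steps reach every tolerance
    (∀ S : (ℝ → Bool) → ℝ → Set ℝ,
      (∀ v, P.IsAdmissible v → P.optFun v < 0 → P.IsSelection η v (S v)) →
      ∀ v₀, P.IsAdmissible v₀ → ∀ ε > 0,
        ∃ (N : ℕ) (σ : ℕ → ℝ → Bool), σ 0 = v₀ ∧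
          (∀ k < N, P.IsStep α β η (S (σ k)) (σ k) (σ (k + 1))) ∧
          P.IsAdmissible (σ N) ∧ -ε < P.optFun (σ N)) := by
  obtain ⟨R, M, h⟩ := SwitchedSystem.exists_regular hT (fun w => (hf w).of_le one_le_two) hL hx
  have hη0 := hα.trans hαη
  refine ⟨fun σ S h0 hstep => ?_, fun S hS v₀ hv₀ ε hε => ?_⟩
  · have hadm : ∀ k, P.IsAdmissible (σ k) := fun k => by
      induction k with
      | zero => exact h0
      | succ k ih => exact (hstep k).isAdmissible hT hβ hβ1 ih
    have hfreq : ∀ ε > 0, ∃ᶠ k in atTop, -ε < P.optFun (σ k) := fun ε hε =>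
      h.frequently_neg_lt_optFun hα hαη hη hβ hβ1 hadm hstep hε
    refine ⟨hadm, le_antisymm ?_ ?_, fun ε hε => (hfreq ε hε).exists⟩
    · exact limsup_le_of_le (by isBoundedDefault)
        (Eventually.of_forall fun k => EReal.coe_nonpos.2 (h.optFun_nonpos (hadm k)))
    · refine le_of_forall_lt fun c hc => ?_
      obtain ⟨r, hcr, hr⟩ := EReal.lt_iff_exists_real_btwn.1 hc
      refine hcr.trans_le (le_limsup_of_frequently_le ?_ (by isBoundedDefault))
      refine (hfreq (-r) (neg_pos.2 (EReal.coe_neg'.1 hr))).mono fun k hk => ?_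
      rw [neg_neg] at hk
      exact EReal.coe_le_coe_iff.2 hk.le
  · classical
    -- The default of staying put only makes the iteration total; wherever D < 0 a genuine step
    -- exists.
    let next : (ℝ → Bool) → ℝ → Bool := fun v =>
      if hv : ∃ v', P.IsStep α β η (S v) v v' then hv.choose else v
    let σ : ℕ → ℝ → Bool := fun k => next^[k] v₀
    have hsucc : ∀ k, σ (k + 1) = next (σ k) := fun k => Function.iterate_succ_apply' _ _ _
    have hadm : ∀ k, P.IsAdmissible (σ k) := fun k => by
      induction k with
      | zero => exact hv₀
      | succ k ih =>
        rw [hsucc]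
        by_cases hv : ∃ v', P.IsStep α β η (S (σ k)) (σ k) v'
        · simp only [next, dif_pos hv]
          exact hv.choose_spec.isAdmissible hT hβ hβ1 ih
        · simpa only [next, dif_neg hv] using ih
    have hstep : ∀ k, P.optFun (σ k) < 0 →
        P.IsStep α β η (S (σ k)) (σ k) (σ (k + 1)) := fun k hk => by
      have hv := h.exists_isStep hη0 hαη hβ hβ1 (hadm k) hk (hS _ (hadm k) hk)
      rw [hsucc]
      simp only [next, dif_pos hv]
      exact hv.choose_spec
    have hex : ∃ k, -ε < P.optFun (σ k) := by
      -- If the tolerance were never reached, all iterates would have D < 0 and form an infinite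
      -- run, to which the convergence result applies.
      by_contra! hle
      obtain ⟨k, hk⟩ := (h.frequently_neg_lt_optFun hα hαη hη hβ hβ1 hadm
        (S := fun k => S (σ k)) (fun k => hstep k ((hle k).trans_lt (neg_neg_of_pos hε)))
        hε).exists
      exact (hle k).not_gt hk
    -- Taking the first index that meets the tolerance ensures that D ≤ -ε < 0 at all earlier ones,
    -- so each earlier transition is a genuine step.
    refine ⟨Nat.find hex, σ, rfl, fun k hk => hstep k ?_, hadm _, Nat.find_spec hex⟩
    exact (not_lt.1 (Nat.find_min hex hk)).trans_lt (neg_neg_of_pos hε)
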